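/- For real vectors $w=(w_1,\dots,w_n)$ and $v=(v_1,\dots,v_n)$ let $S_\pi=\sum_{i=1}^n w_i v_{\pi(i)}$, where $\pi$ is a uniformly random permutation of $[n]=\{1,\dots,n\}$. For $A>0$, call $w$ *non-degenerate with constant $A$* if $\sum_i w_i=0$, $\sum_i w_i^2=1$, and $|w_i-w_j|\le \frac{1}{A\sqrt{\log n}}$ for all distinct $i,j$. **Theorem.** Let $d\ge 2$ be an integer and let $\delta>0$, $b\ne 0$, $B>0$ be real constants. There is $A_0=A_0(d,\delta,b,B)>0$ such that the following holds for every $A\ge A_0$ and every $n$. Let $w$ be non-degenerate with constant $A$, let $I\subseteq[n]$ satisfy $|I|\ge\delta n$, and let $v\in\mathbb R^n$ be such that $$v_i=\frac{P_d(i)}{n^d}\quad\text{and}\quad |v_i|\le B\qquad\text{for all } i\in I,$$ where $P_d$ is a real polynomial of degree $d$ with leading coefficient $b$ (its other coefficients may depend on $n$; the entries $v_i$ with $i\notin I$ are arbitrary). Then for every $L\in\mathbb R$ $$\mathbb P\Bigl(|S_\pi-L|\le \tfrac1n\Bigr)\le \frac{C_1}{n}.$$ If in addition $|v_i|\le\widetilde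 B$ for all $i\in[n]$, for some $\widetilde B>0$, then for every $L\in\mathbb R$ $$\mathbb P\Bigl(|S_\pi-L|\le \tfrac1n\Bigr)\le \frac{C_2}{n}\,e^{-c_2L^2}.$$ Here $C_1>0$ depends only on $A$, and $C_2,c_2>0$ depend only on $A$, $B$ and $\widetilde B$. -/

import Mathlib

/-- The permutation sum `S_π(w, v) = ∑ i, w i * v (π i)`. -/
def permSum {n : ℕ} (w v : Fin n → ℝ) (π : Equiv.Perm (Fin n)) : ℝ :=
  ∑ i, w i * v (π i)

/-- The probability of an event for a uniformly random permutation of `n` letters. -/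
noncomputable def permProb {n : ℕ} (E : Set (Equiv.Perm (Fin n))) : ℝ :=
  (E.ncard : ℝ) / (n.factorial : ℝ)

/-- Non-degeneracy with constant `A`: `w` is a unit vector with zero sum whose entries
differ pairwise by at most `1 / (A * √(log n))`.  (The first two conditions force `2 ≤ n`,
so `log n` is positive.) -/
structure IsNondegenerate {n : ℕ} (A : ℝ) (w : Fin n → ℝ) : Prop where
  sum_eq_zero : ∑ i, w i = 0
  sum_sq_eq_one : ∑ i, (w i) ^ 2 = 1
  separation : ∀ i j, i ≠ j → |w i - w j| ≤ 1 / (A * Real.sqrt (Real.log (n : ℝ)))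

/-- On the index set `I`, the sequence `v` is given by `v_i = P(i) / n ^ d`, where `P` is a real
polynomial of degree `d` with leading coefficient `b`, and it is bounded there by `B`.
The index `i ∈ {1, …, n}` corresponds to `k : Fin n` with `i = k + 1`. -/
structure IsPolynomialOn {n : ℕ} (d : ℕ) (b B : ℝ) (P : Polynomial ℝ)
    (I : Finset (Fin n)) (v : Fin n → ℝ) : Prop where
  natDegree_eq : P.natDegree = d
  leadingCoeff_eq : P.leadingCoeff = b
  apply_eq : ∀ k ∈ I, v k = P.eval (((k : ℕ) : ℝ) + 1) / (n : ℝ) ^ d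
  abs_le : ∀ k ∈ I, |v k| ≤ B

/-! The proof is Fourier analysis of the tilted sum $E\,e^{(l+it)S_\pi}$. Smoothing with a Fejér
kernel (`ncard_near_mul_le`) reduces both bounds to showing that the norm of this transform,
relative to the exponential moment of the tilt, has bounded integral over $0\le t\le n$.

Exchanging the images of $x$ and $y$ changes $S_\pi$ by $(w_x-w_y)(v_{\pi(y)}-v_{\pi(x)})$.
Averaging over swaps of disjoint pairs produces a product of factors $(1+e^{(l+it)D_k})/2$, each
damped by $1-\frac14\sin^2(tD_k/2)$ (`norm_sum_exp_permSum_le`). Cauchy–Schwarz separates the tilt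
from the damping, and revealing $\pi$ pair by pair (`sum_prod_one_sub_le`) replaces each $\sin^2$ by
its average over pairs of values of $v$.

With $\theta=t(w_x-w_y)$ this average is at least a constant times $\min(1,\theta^2)$ for
$|\theta|\le\kappa n$: a polynomial with leading coefficient $b\ne0$ has large slope at most grid
points, so the values $\theta v_k$ cannot concentrate modulo $2\pi$ (`exists_le_sum_sin_sq`). Since
the chosen pairs carry a constant share of $\sum w_i^2$ and all gaps are at most $1/(A\sqrt{\log
n})$, the damping is Gaussian in $t$ up to $A\sqrt{\log n}$ and at most $1/n$ beyond
(`exp_neg_sum_min_le`).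

The tilt $l=0$ gives the first bound. For the second, $l$ is proportional to $L$ and the exponential
moment is controlled by a sub-Gaussian estimate (`sum_exp_mul_permSum_le`); if $|L|$ is too large
for that tilt, Chernoff's inequality alone also pays for the factor $1/n$. -/

/-! ### Averaging over swaps and over random permutations -/

/-- Averaging over independent right multiplications by the elements `σ k`. -/
theorem sum_mul_prod_one_add_div_two {G ι R : Type*} [Group G] [Fintype G] [DecidableEq ι]
    [Field R] [CharZero R] (σ : ι → G) (e : G → R) (r : ι → G → R)
    (he : ∀ k g, e (g * σ k) = e g * r k g)
    (hr : ∀ k l, k ≠ l → ∀ g, r k (g * σ l) = r k g) (K : Finset ι) :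
    ∑ g, e g * ∏ k ∈ K, (1 + r k g) / 2 = ∑ g, e g := by
  induction K using Finset.induction_on with
  | empty => simp
  | insert k K hk ih =>
    -- The substitution `g ↦ g * σ k` turns `e` into `e * r k` and leaves the other factors alone.
    have h1 : ∑ g, e g * r k g * ∏ l ∈ K, (1 + r l g) / 2 = ∑ g, e g := by
      rw [← ih, ← Equiv.sum_comp (Equiv.mulRight (σ k)) (fun g => e g * ∏ l ∈ K, (1 + r l g) / 2)]
      refine Finset.sum_congr rfl fun g _ => ?_
      simp only [Equiv.coe_mulRight, he]
      congr 1
      refine Finset.prod_congr rfl fun l hl => ?_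
      rw [hr l k (fun h => hk (h ▸ hl))]
    have h2 : ∀ g, e g * ∏ l ∈ insert k K, (1 + r l g) / 2 =
        (e g * ∏ l ∈ K, (1 + r l g) / 2 + e g * r k g * ∏ l ∈ K, (1 + r l g) / 2) / 2 := by
      intro g
      rw [Finset.prod_insert hk]
      ring
    rw [Finset.sum_congr rfl fun g _ => h2 g, ← Finset.sum_div, Finset.sum_add_distrib, h1, ih]
    ring

/-- With $y=e^u$ and $S=\sin^2(s/2)$, $|1+e^{u+is}|^2=(1+y)^2-4yS$. The bound $|u|\le1$ puts $y$ in
$[1/3,3]$, where $(1+y)^2\le 8y$; this makes the loss at least $(1+y)^2S/2$. -/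
theorem norm_one_add_exp_div_two_le (u s : ℝ) (hu : |u| ≤ 1) :
    ‖(1 + Complex.exp (u + s * Complex.I)) / 2‖ ≤
      (1 + Real.exp u) / 2 * (1 - 1 / 4 * Real.sin (s / 2) ^ 2) := by
  have hy0 : 0 < Real.exp u := Real.exp_pos u
  have hy1 : Real.exp u ≤ 3 :=
    (Real.exp_le_exp.2 (abs_le.1 hu).2).trans (Real.exp_one_lt_d9.le.trans (by norm_num))
  have hy2 : 1 / 3 ≤ Real.exp u := by
    have h : Real.exp (-u) ≤ 3 :=
      (Real.exp_le_exp.2 (by linarith [(abs_le.1 hu).1])).trans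
        (Real.exp_one_lt_d9.le.trans (by norm_num))
    rw [Real.exp_neg] at h
    rw [one_div]
    exact inv_le_of_inv_le₀ hy0 h
  have hS1 : Real.sin (s / 2) ^ 2 ≤ 1 := Real.sin_sq_le_one _
  have hS0 : 0 ≤ Real.sin (s / 2) ^ 2 := sq_nonneg _
  have hcos : Real.cos s = 1 - 2 * Real.sin (s / 2) ^ 2 := by
    have := Real.cos_two_mul (s / 2)
    rw [mul_div_cancel₀ _ two_ne_zero, Real.cos_sq'] at this
    linarith
  have hsq : ‖1 + Complex.exp (u + s * Complex.I)‖ ^ 2 =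
      (1 + Real.exp u) ^ 2 - 4 * Real.exp u * Real.sin (s / 2) ^ 2 := by
    rw [← Complex.normSq_eq_norm_sq, Complex.normSq_apply]
    simp only [Complex.add_re, Complex.one_re, Complex.add_im, Complex.one_im, Complex.exp_re,
      Complex.exp_im, Complex.ofReal_re, Complex.ofReal_im, Complex.mul_re, Complex.mul_im,
      Complex.I_re, Complex.I_im]
    ring_nf
    have := Real.sin_sq_add_cos_sq s
    have h3 : Real.exp u * Real.cos s = Real.exp u * (1 - 2 * Real.sin (s / 2) ^ 2) := by
      rw [hcos]
    have h4 : Real.exp u ^ 2 * Real.cos s ^ 2 + Real.exp u ^ 2 * Real.sin s ^ 2 =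
        Real.exp u ^ 2 := by rw [← mul_add, add_comm, this, mul_one]
    have e1 : s * (1 / 2) = s / 2 := by ring
    simp only [e1]
    linarith
  rw [norm_div, Complex.norm_two, div_mul_eq_mul_div]
  refine div_le_div_of_nonneg_right ?_ two_pos.le
  refine le_of_sq_le_sq ?_ (by nlinarith)
  rw [hsq]
  set y := Real.exp u
  set S := Real.sin (s / 2) ^ 2
  have h5 : (1 + y) ^ 2 ≤ 8 * y := by nlinarith
  nlinarith [mul_nonneg hS0 (sub_nonneg.2 h5), mul_nonneg (sq_nonneg (1 + y)) (sq_nonneg S)]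

/-- A permutation fixing `T` and moving one ordered pair outside `T` to another one. -/
theorem exists_perm_fixing_map_pair {α : Type*} [DecidableEq α] {T : Finset α} {x y a b : α}
    (hx : x ∉ T) (hy : y ∉ T) (ha : a ∉ T) (hb : b ∉ T) (hxy : x ≠ y) (hab : a ≠ b) :
    ∃ τ : Equiv.Perm α, (∀ i ∈ T, τ i = i) ∧ τ x = a ∧ τ y = b := by
  set c := Equiv.swap x a y with hc
  have hcT : c ∉ T := by
    rw [hc, Equiv.swap_apply_def]
    split_ifs <;> assumption
  have hca : c ≠ a := by
    intro h
    have : Equiv.swap x a y = Equiv.swap x a x := by rw [← hc, h, Equiv.swap_apply_left]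
    exact hxy ((Equiv.swap x a).injective this).symm
  refine ⟨Equiv.swap c b * Equiv.swap x a, fun i hi => ?_, ?_, ?_⟩
  · have h : ∀ j, j ∉ T → i ≠ j := fun j hj h => hj (h ▸ hi)
    rw [Equiv.Perm.mul_apply, Equiv.swap_apply_of_ne_of_ne (h _ hx) (h _ ha),
      Equiv.swap_apply_of_ne_of_ne (h _ hcT) (h _ hb)]
  · rw [Equiv.Perm.mul_apply, Equiv.swap_apply_left,
      Equiv.swap_apply_of_ne_of_ne hca.symm hab]
  · rw [Equiv.Perm.mul_apply, ← hc, Equiv.swap_apply_left]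

/-- By `hinv`, `G` depends only on the restriction of `π` to `T`. Given that restriction, the images
of `x, y` are a uniform ordered pair of distinct remaining values, so `g` may be averaged over all
of them. -/
theorem mul_sum_le_sum_mul_apply_pair {α : Type*} [Fintype α] [DecidableEq α] (T : Finset α)
    {x y : α} (hx : x ∉ T) (hy : y ∉ T) (hxy : x ≠ y) (G : Equiv.Perm α → ℝ) (hG : ∀ π, 0 ≤ G π)
    (hinv : ∀ π τ : Equiv.Perm α, (∀ i ∈ T, τ i = i) → G (π * τ) = G π)
    (g : α → α → ℝ) (ρ : ℝ)
    (hρ : ∀ π : Equiv.Perm α, ρ * (Tᶜ.offDiag.card : ℝ) ≤ ∑ p ∈ Tᶜ.offDiag, g (π p.1) (π p.2)) :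
    ρ * ∑ π, G π ≤ ∑ π, G π * g (π x) (π y) := by
  have hpos : 0 < (Tᶜ.offDiag.card : ℝ) := by
    rw [Nat.cast_pos, Finset.card_pos]
    exact ⟨(x, y), by simp [hx, hy, hxy]⟩
  have h1 : ∀ p ∈ Tᶜ.offDiag,
      ∑ π, G π * g (π x) (π y) = ∑ π, G π * g (π p.1) (π p.2) := by
    rintro ⟨a, b⟩ hp
    simp only [Finset.mem_offDiag, Finset.mem_compl] at hp
    obtain ⟨τ, hτ, h2, h3⟩ := exists_perm_fixing_map_pair hx hy hp.1 hp.2.1 hxy hp.2.2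
    rw [← Equiv.sum_comp (Equiv.mulRight τ) (fun π => G π * g (π x) (π y))]
    refine Finset.sum_congr rfl fun π _ => ?_
    simp [hinv π τ hτ, h2, h3]
  have h2 : (Tᶜ.offDiag.card : ℝ) * ∑ π, G π * g (π x) (π y) =
      ∑ π, G π * ∑ p ∈ Tᶜ.offDiag, g (π p.1) (π p.2) := by
    rw [← nsmul_eq_mul, ← Finset.sum_const, Finset.sum_congr rfl h1, Finset.sum_comm]
    simp only [Finset.mul_sum]
  refine le_of_mul_le_mul_left ?_ hpos
  rw [h2, Finset.mul_sum, Finset.mul_sum]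
  refine Finset.sum_le_sum fun π _ => ?_
  nlinarith [mul_le_mul_of_nonneg_left (hρ π) (hG π)]

/-- The pairs are revealed one at a time. `T` is the set of indices already revealed, which is why
`hρ` is asked for every small `T`. -/
theorem sum_prod_one_sub_le {α ι : Type*} [Fintype α] [DecidableEq α] [Fintype ι] [DecidableEq ι]
    {x y : ι → α} (hx : Function.Injective x) (hy : Function.Injective y) (hxy : ∀ k l, x k ≠ y l)
    (g : ι → α → α → ℝ) (hg1 : ∀ k a b, g k a b ≤ 1) (ρ : ι → ℝ) (hρ1 : ∀ k, ρ k ≤ 1)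
    (hρ : ∀ (k : ι) (T : Finset α), T.card ≤ 2 * Fintype.card ι → ∀ π : Equiv.Perm α,
      ρ k * (Tᶜ.offDiag.card : ℝ) ≤ ∑ p ∈ Tᶜ.offDiag, g k (π p.1) (π p.2)) (K : Finset ι) :
    ∑ π : Equiv.Perm α, ∏ k ∈ K, (1 - g k (π (x k)) (π (y k))) ≤
      (∏ k ∈ K, (1 - ρ k)) * ((Fintype.card α).factorial : ℝ) := by
  induction K using Finset.induction_on with
  | empty => simp [Fintype.card_perm]
  | insert k K hk ih =>
    set T := K.image x ∪ K.image y with hT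
    have hTc : T.card ≤ 2 * Fintype.card ι := by
      have h1 := Finset.card_union_le (K.image x) (K.image y)
      have h2 := Finset.card_image_le (s := K) (f := x)
      have h3 := Finset.card_image_le (s := K) (f := y)
      have h4 := Finset.card_le_univ K
      rw [← hT] at h1
      omega
    have hmem : ∀ l ∈ K, x l ∈ T ∧ y l ∈ T := fun l hl =>
      ⟨Finset.mem_union_left _ (Finset.mem_image_of_mem x hl),
        Finset.mem_union_right _ (Finset.mem_image_of_mem y hl)⟩
    have hxT : x k ∉ T := by
      simp only [hT, Finset.mem_union, Finset.mem_image, not_or, not_exists, not_and]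
      exact ⟨fun l hl h => hk (hx h ▸ hl), fun l hl h => hxy k l h.symm⟩
    have hyT : y k ∉ T := by
      simp only [hT, Finset.mem_union, Finset.mem_image, not_or, not_exists, not_and]
      exact ⟨fun l hl h => hxy l k h, fun l hl h => hk (hy h ▸ hl)⟩
    have key := mul_sum_le_sum_mul_apply_pair T hxT hyT (hxy k k)
      (fun π => ∏ l ∈ K, (1 - g l (π (x l)) (π (y l))))
      (fun π => Finset.prod_nonneg fun l _ => sub_nonneg.2 (hg1 _ _ _))
      (fun π τ hτ => Finset.prod_congr rfl fun l hl => by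
        simp [hτ _ (hmem l hl).1, hτ _ (hmem l hl).2])
      (g k) (ρ k) (hρ k T hTc)
    simp only [Finset.prod_insert hk, sub_mul, one_mul, Finset.sum_sub_distrib]
    have h5 : ∀ π : Equiv.Perm α, g k (π (x k)) (π (y k)) *
        ∏ l ∈ K, (1 - g l (π (x l)) (π (y l))) =
        (∏ l ∈ K, (1 - g l (π (x l)) (π (y l)))) * g k (π (x k)) (π (y k)) :=
      fun π => mul_comm _ _
    simp only [h5]
    have h6 := mul_le_mul_of_nonneg_left ih (sub_nonneg.2 (hρ1 k))
    linarith

/-- First moment method: under a random `τ` each squared gap has mean $2n/(n(n-1))\ge 2/n$. -/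
theorem exists_perm_le_sum_sq_sub {n : ℕ} (w : Fin n → ℝ) (h0 : ∑ i, w i = 0)
    (h1 : ∑ i, w i ^ 2 = 1) {ι : Type*} [Fintype ι] {x y : ι → Fin n} (hxy : ∀ k, x k ≠ y k) :
    ∃ τ : Equiv.Perm (Fin n),
      2 * (Fintype.card ι : ℝ) / n ≤ ∑ k, (w (τ (x k)) - w (τ (y k))) ^ 2 := by
  rcases Nat.eq_zero_or_pos n with rfl | hn
  · simp at h1
  have hn' : (0 : ℝ) < n := Nat.cast_pos.2 hn
  have hsum : ∑ p ∈ (Finset.univ : Finset (Fin n)).offDiag, (w p.1 - w p.2) ^ 2 = 2 * n := by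
    have e1 : ∑ p ∈ (Finset.univ : Finset (Fin n)).offDiag, (w p.1 - w p.2) ^ 2 =
        ∑ p : Fin n × Fin n, (w p.1 - w p.2) ^ 2 := by
      refine Finset.sum_subset (Finset.subset_univ _) fun p _ hp => ?_
      simp only [Finset.mem_offDiag, Finset.mem_univ, true_and, ne_eq, not_not] at hp
      simp [hp]
    rw [e1, Fintype.sum_prod_type]
    simp only [sub_sq, Finset.sum_add_distrib, Finset.sum_sub_distrib, ← Finset.mul_sum, h0, h1,
      Finset.sum_const, Finset.card_univ, Fintype.card_fin, nsmul_eq_mul]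
    simp
    ring
  have key : ∀ k, (2 / n : ℝ) * ∑ _π : Equiv.Perm (Fin n), (1 : ℝ) ≤
      ∑ π : Equiv.Perm (Fin n), 1 * (w (π (x k)) - w (π (y k))) ^ 2 := by
    intro k
    refine mul_sum_le_sum_mul_apply_pair (∅ : Finset (Fin n)) (by simp) (by simp) (hxy k)
      (fun _ => 1) (fun _ => zero_le_one) (fun _ _ _ => rfl) (fun a b => (w a - w b) ^ 2) (2 / n)
      fun π => ?_
    have e2 : ∑ p ∈ (∅ : Finset (Fin n))ᶜ.offDiag, (w (π p.1) - w (π p.2)) ^ 2 = 2 * n := by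
      rw [← hsum, Finset.compl_empty]
      refine Finset.sum_equiv (Equiv.prodCongr π π) (by simp) (by simp)
    rw [e2, Finset.compl_empty, Finset.offDiag_card, Finset.card_univ, Fintype.card_fin,
      Nat.cast_sub (Nat.le_mul_self n), Nat.cast_mul, div_mul_eq_mul_div, div_le_iff₀ hn']
    nlinarith
  by_contra! hcon
  have h2 := Finset.sum_lt_sum_of_nonempty (Finset.univ_nonempty (α := Equiv.Perm (Fin n)))
    (fun π _ => hcon π)
  rw [Finset.sum_comm] at h2
  have h3 := Finset.sum_le_sum (s := Finset.univ) fun k (_ : k ∈ Finset.univ) => key k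
  simp only [one_mul, Finset.sum_const, nsmul_eq_mul] at h2 h3
  simp only [Finset.card_univ] at h2 h3
  have h4 : (Fintype.card ι : ℝ) * (2 / n * ((Fintype.card (Equiv.Perm (Fin n)) : ℝ) * 1)) =
     (Fintype.card (Equiv.Perm (Fin n)) : ℝ) * (2 * (Fintype.card ι : ℝ) / n) := by ring
  linarith

/-! ### Polynomials on dense subsets of a grid -/

open Polynomial in
theorem abs_coeff_prod_linear_le {ι : Type*} (s : Finset ι) (a b : ι → ℝ) {r : ℝ} (hr : 0 ≤ r)
    (ha : ∀ i ∈ s, |a i| ≤ r) (hb : ∀ i ∈ s, |b i| ≤ r) (j : ℕ) :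
    |(∏ i ∈ s, (C (a i) * X + C (b i))).coeff j| ≤ (2 * r) ^ s.card := by
  classical
  induction s using Finset.induction_on generalizing j with
  | empty =>
    simp only [Finset.prod_empty, Finset.card_empty, pow_zero, coeff_one]
    split_ifs <;> simp
  | insert i s hi ih =>
    have ih' := ih (fun k hk => ha k (Finset.mem_insert_of_mem hk))
      (fun k hk => hb k (Finset.mem_insert_of_mem hk))
    have ha' := ha i (Finset.mem_insert_self _ _)
    have hb' := hb i (Finset.mem_insert_self _ _)
    rw [Finset.prod_insert hi, Finset.card_insert_of_notMem hi, add_mul, coeff_add, coeff_C_mul,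
      mul_assoc, coeff_C_mul, pow_succ]
    set Q := ∏ i ∈ s, (C (a i) * X + C (b i))
    have h1 : |a i * (X * Q).coeff j| ≤ r * (2 * r) ^ s.card := by
      rw [abs_mul]
      refine mul_le_mul ha' ?_ (abs_nonneg _) hr
      cases j with
      | zero => simp; positivity
      | succ j => rw [coeff_X_mul]; exact ih' j
    have h2 : |b i * Q.coeff j| ≤ r * (2 * r) ^ s.card := by
      rw [abs_mul]
      exact mul_le_mul hb' (ih' j) (abs_nonneg _) hr
    calc _ ≤ _ := abs_add_le _ _
      _ ≤ _ := add_le_add h1 h2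
      _ = _ := by ring

open Polynomial in
/-- A polynomial bounded at well-separated nodes has bounded coefficients. -/
theorem abs_coeff_le_of_separated {e : ℕ} {q : ℝ[X]} (hq : q.natDegree ≤ e) {x : Fin (e + 1) → ℝ}
    {g M : ℝ} (hg : 0 < g) (hx : ∀ i, |x i| ≤ 1) (hsep : ∀ i j, i ≠ j → g ≤ |x i - x j|)
    (hM : ∀ i, |q.eval (x i)| ≤ M) (j : ℕ) :
    |q.coeff j| ≤ M * ((e + 1) * (2 / g) ^ e) := by
  have hinj : Set.InjOn x (Finset.univ : Finset (Fin (e + 1))) := by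
    intro i _ k _ h
    by_contra hne
    have := hsep i k hne
    rw [h, sub_self, abs_zero] at this
    linarith
  have hdeg : q.degree < (Finset.univ : Finset (Fin (e + 1))).card := by
    rw [Finset.card_univ, Fintype.card_fin]
    refine lt_of_le_of_lt degree_le_natDegree ?_
    exact_mod_cast Nat.lt_succ_of_le hq
  have hM0 : 0 ≤ M := (abs_nonneg _).trans (hM 0)
  rw [Lagrange.eq_interpolate hinj hdeg, Lagrange.interpolate_apply, finsetSum_coeff]
  refine (Finset.abs_sum_le_sum_abs _ _).trans ?_
  have hb : ∀ i ∈ (Finset.univ : Finset (Fin (e + 1))),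
      |(C (q.eval (x i)) * Lagrange.basis Finset.univ x i).coeff j| ≤ M * (2 / g) ^ e := by
    intro i _
    rw [coeff_C_mul, abs_mul]
    refine mul_le_mul (hM i) ?_ (abs_nonneg _) hM0
    have e1 : Lagrange.basis Finset.univ x i = ∏ k ∈ Finset.univ.erase i,
        (C ((x i - x k)⁻¹) * X + C (-((x i - x k)⁻¹ * x k))) := by
      rw [Lagrange.basis]
      refine Finset.prod_congr rfl fun k _ => ?_
      rw [Lagrange.basisDivisor, mul_sub, C_neg, C_mul, sub_eq_add_neg]
    have hinv : ∀ k ∈ Finset.univ.erase i, |(x i - x k)⁻¹| ≤ 1 / g := by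
      intro k hk
      rw [abs_inv, ← one_div]
      exact one_div_le_one_div_of_le hg (hsep i k (Finset.ne_of_mem_erase hk).symm)
    have := abs_coeff_prod_linear_le (Finset.univ.erase i) (fun k => (x i - x k)⁻¹)
      (fun k => -((x i - x k)⁻¹ * x k)) (r := 1 / g) (by positivity) hinv
      (fun k hk => by
        rw [abs_neg, abs_mul]
        exact (mul_le_mul (hinv k hk) (hx k) (abs_nonneg _) (by positivity)).trans_eq (mul_one _)) j
    rw [e1]
    simpa [Finset.card_erase_of_mem, mul_one_div, div_eq_mul_inv] using this
  refine (Finset.sum_le_sum hb).trans_eq ?_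
  rw [Finset.sum_const, Finset.card_univ, Fintype.card_fin, nsmul_eq_mul]
  push_cast
  ring

/-- Every `s`-th element of `G` in increasing order is taken. -/
theorem exists_separated_of_card {n : ℕ} (G : Finset (Fin n)) {e s : ℕ} (hs : e * s < G.card) :
    ∃ f : Fin (e + 1) → Fin n, (∀ i, f i ∈ G) ∧ ∀ i j, i < j → (f i : ℕ) + s ≤ f j := by
  have hstep : ∀ r a (h : a + r < G.card),
      ((G.orderEmbOfFin rfl ⟨a, by omega⟩ : Fin n) : ℕ) + r ≤ G.orderEmbOfFin rfl ⟨a + r, h⟩ := by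
    intro r
    induction r with
    | zero => intro a h; simp
    | succ r ih =>
      intro a h
      have h1 := ih a (by omega)
      have h2 : G.orderEmbOfFin rfl ⟨a + r, by omega⟩ < G.orderEmbOfFin rfl ⟨a + (r + 1), h⟩ :=
        (G.orderEmbOfFin rfl).strictMono (Fin.mk_lt_mk.2 (by omega))
      have h3 := Fin.lt_def.1 h2
      omega
  have hlt : ∀ i : Fin (e + 1), (i : ℕ) * s < G.card := fun i =>
    (Nat.mul_le_mul_right s (Nat.le_of_lt_succ i.2)).trans_lt hs
  refine ⟨fun i => G.orderEmbOfFin rfl ⟨i * s, hlt i⟩, fun i => G.orderEmbOfFin_mem rfl _,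
    fun i j hij => ?_⟩
  have hle : (i : ℕ) * s + s ≤ j * s := by
    have : (i : ℕ) + 1 ≤ j := hij
    nlinarith
  have h1 := hstep (j * s - i * s) (i * s) (by have := hlt j; omega)
  have h2 : (⟨i * s + (j * s - i * s), by have := hlt j; omega⟩ : Fin G.card) = ⟨j * s, hlt j⟩ :=
    Fin.ext (by simp only; omega)
  rw [h2] at h1
  beta_reduce
  omega

/-- The factor relating values on a set of density `γ` of grid points to coefficients. -/
noncomputable def coeffFactor (e : ℕ) (γ : ℝ) : ℝ :=
  (e + 1) * (2 / (γ / (2 * (e + 1)))) ^ e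

theorem coeffFactor_pos (e : ℕ) {γ : ℝ} (hγ : 0 < γ) : 0 < coeffFactor e γ := by
  unfold coeffFactor
  positivity

theorem grid_mem_Icc {n : ℕ} (k : Fin n) : (((k : ℕ) : ℝ) + 1) / n ∈ Set.Icc (0 : ℝ) 1 := by
  have hn : (0 : ℝ) < n := Nat.cast_pos.2 (Nat.pos_of_ne_zero fun h => by
    have := k.2
    omega)
  refine ⟨by positivity, (div_le_one hn).2 ?_⟩
  exact_mod_cast k.2

open Polynomial in
theorem abs_coeff_le_of_grid {e n : ℕ} {γ M : ℝ} (hγ : 0 < γ) (hn : 2 * (e + 1) ≤ γ * n)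
    {G : Finset (Fin n)} (hG : γ * n ≤ G.card) {q : ℝ[X]} (hq : q.natDegree ≤ e)
    (hM : ∀ k ∈ G, |q.eval ((((k : ℕ) : ℝ) + 1) / n)| ≤ M) (j : ℕ) :
    |q.coeff j| ≤ M * coeffFactor e γ := by
  have hn0 : (0 : ℝ) < n := by
    by_contra h
    have : (n : ℝ) = 0 := le_antisymm (not_lt.1 h) (Nat.cast_nonneg n)
    rw [this] at hn
    have : (0 : ℝ) ≤ e := Nat.cast_nonneg e
    linarith
  -- Spacing `s` yields `e + 1` interpolation nodes in `G`; rounding down costs at most the factor 2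
  -- seen in `coeffFactor`.
  set s := G.card / (e + 1) with hs
  have hs1 : γ * n / (2 * (e + 1)) ≤ s := by
    have h1 : G.card < (s + 1) * (e + 1) := by
      have := Nat.lt_mul_div_succ G.card (Nat.succ_pos e)
      rw [mul_comm]; exact this
    have h2 : (G.card : ℝ) < (s + 1) * (e + 1) := by exact_mod_cast h1
    have he : (0 : ℝ) < e + 1 := by positivity
    rw [div_le_iff₀ (by positivity)]
    nlinarith
  have hs0 : 0 < s := by
    have : (1 : ℝ) ≤ s := le_trans ((one_le_div (by positivity)).2 hn) hs1
    exact_mod_cast this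
  have hsG : e * s < G.card := by
    have := Nat.div_mul_le_self G.card (e + 1)
    rw [← hs] at this
    nlinarith
  obtain ⟨f, hfG, hf⟩ := exists_separated_of_card G hsG
  have hlt : ∀ i j, i < j → γ / (2 * (e + 1)) ≤
      |(((f i : ℕ) : ℝ) + 1) / n - (((f j : ℕ) : ℝ) + 1) / n| := by
    intro i j hij
    have h1 : ((f i : ℕ) : ℝ) + s ≤ (f j : ℕ) := by exact_mod_cast hf i j hij
    rw [abs_sub_comm, ← sub_div]
    refine le_trans ?_ (le_abs_self _)
    rw [le_div_iff₀ hn0, div_mul_eq_mul_div]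
    linarith
  refine abs_coeff_le_of_separated hq (x := fun i => (((f i : ℕ) : ℝ) + 1) / n) (by positivity)
    (fun i => ?_) (fun i j hij => ?_) (fun i => hM _ (hfG i)) j
  · have := grid_mem_Icc (f i)
    rw [abs_of_nonneg this.1]
    exact this.2
  · rcases lt_or_gt_of_ne hij with h | h
    · exact hlt i j h
    · rw [abs_sub_comm]
      exact hlt j i h

/-- In each block of length `R₂`, all elements of `E` lie within `R₁` of the smallest one. -/
theorem card_le_of_forbidden_differences {n R₁ R₂ : ℕ} (hR₂ : 0 < R₂) (E : Finset (Fin n))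
    (hE : ∀ k ∈ E, ∀ l ∈ E, (k : ℕ) + R₁ ≤ l → ¬ (l : ℕ) < k + R₂) :
    E.card ≤ R₁ * (n / R₂ + 1) := by
  have hmaps : ∀ k ∈ E, (k : ℕ) / R₂ ∈ Finset.range (n / R₂ + 1) := fun k _ =>
    Finset.mem_range.2 (Nat.lt_succ_of_le (Nat.div_le_div_right k.2.le))
  have := Finset.card_le_mul_card_image_of_maps_to hmaps R₁ fun c _ => ?_
  · simpa using this
  · rcases (E.filter fun k : Fin n => (k : ℕ) / R₂ = c).eq_empty_or_nonempty with h | h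
    · rw [h]; simp
    obtain ⟨a, ha, hmin⟩ := Finset.exists_min_image _ (fun k : Fin n => (k : ℕ)) h
    have hsub : (E.filter fun k : Fin n => (k : ℕ) / R₂ = c).map Fin.valEmbedding ⊆
        Finset.Ico (a : ℕ) (a + R₁) := by
      intro t ht
      obtain ⟨k, hk, rfl⟩ := Finset.mem_map.1 ht
      have h1 := hmin k hk
      rw [Finset.mem_filter] at hk ha
      rw [Fin.valEmbedding_apply, Finset.mem_Ico]
      refine ⟨h1, ?_⟩
      by_contra h2
      refine hE a ha.1 k hk.1 (not_lt.1 h2) ?_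
      have h3 := Nat.div_add_mod (k : ℕ) R₂
      have h4 := Nat.div_add_mod (a : ℕ) R₂
      have h5 := Nat.mod_lt (k : ℕ) hR₂
      rw [hk.2] at h3
      rw [ha.2] at h4
      omega
    have := Finset.card_le_card hsub
    simpa using this

open Polynomial in
theorem abs_eval_le_of_coeff {q : ℝ[X]} {e : ℕ} {M : ℝ} (hq : q.natDegree ≤ e)
    (hM : ∀ i, |q.coeff i| ≤ M) {x : ℝ} (hx : x ∈ Set.Icc (0 : ℝ) 1) :
    |q.eval x| ≤ (e + 1) * M := by
  rw [eval_eq_sum_range' (Nat.lt_succ_of_le hq)]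
  refine (Finset.abs_sum_le_sum_abs _ _).trans ?_
  have : ∀ i ∈ Finset.range (e + 1), |q.coeff i * x ^ i| ≤ M := by
    intro i _
    rw [abs_mul, abs_of_nonneg (pow_nonneg hx.1 i)]
    exact (mul_le_mul (hM i) (pow_le_one₀ hx.1 hx.2) (pow_nonneg hx.1 i)
      ((abs_nonneg _).trans (hM 0))).trans_eq (mul_one _)
  refine (Finset.sum_le_sum this).trans_eq ?_
  rw [Finset.sum_const, Finset.card_range, nsmul_eq_mul]
  push_cast
  ring

open Polynomial in
theorem abs_coeff_derivative_le {q : ℝ[X]} {e : ℕ} {M : ℝ} (hq : q.natDegree ≤ e)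
    (hM : ∀ i, |q.coeff i| ≤ M) (i : ℕ) : |q.derivative.coeff i| ≤ e * M := by
  have hM0 : 0 ≤ M := (abs_nonneg _).trans (hM 0)
  rw [coeff_derivative, abs_mul, mul_comm]
  rcases lt_or_ge e (i + 1) with h | h
  · rw [coeff_eq_zero_of_natDegree_lt (hq.trans_lt h), abs_zero, mul_zero]
    positivity
  · refine mul_le_mul ?_ (hM _) (abs_nonneg _) (Nat.cast_nonneg e)
    rw [abs_of_nonneg (by positivity)]
    exact_mod_cast h

open Polynomial in
theorem exists_eval_sub_eq (q : ℝ[X]) {x y : ℝ} (hxy : x < y) :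
    ∃ z ∈ Set.Ioo x y, q.eval y - q.eval x = q.derivative.eval z * (y - x) := by
  obtain ⟨z, hz, h⟩ := exists_deriv_eq_slope (fun t => q.eval t) hxy q.continuous.continuousOn
    q.differentiable.differentiableOn
  refine ⟨z, hz, ?_⟩
  rw [Polynomial.deriv] at h
  rw [h, div_mul_cancel₀ _ (sub_ne_zero.2 hxy.ne')]

/-! ### Non-concentration of polynomial values modulo a period -/

theorem half_abs_le_abs_sin {y : ℝ} (hy : |y| ≤ 1) : |y| / 2 ≤ |Real.sin y| := by
  have h := Real.mul_abs_le_abs_sin (x := y) (hy.trans (by linarith [Real.pi_gt_three]))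
  refine le_trans ?_ h
  have h2 : 1 / 2 ≤ 2 / Real.pi := by
    rw [div_le_div_iff₀ two_pos Real.pi_pos]
    linarith [Real.pi_le_four]
  nlinarith [mul_le_mul_of_nonneg_right h2 (abs_nonneg y)]

open Polynomial in
-- Take $p(x)=P(nx)/n^d$. The leading coefficient stays $b$, and boundedness on a set of positive
-- density bounds all coefficients uniformly in $n$, although those of $P$ may vary with $n$.
theorem IsPolynomialOn.exists_rescaled {n d : ℕ} {b B δ : ℝ} {P : ℝ[X]} {J : Finset (Fin n)}
    {v : Fin n → ℝ} (h : IsPolynomialOn d b B P J v) (hδ : 0 < δ) (hJ : δ * n ≤ J.card)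
    (hn : 2 * (d + 1) ≤ δ * n) :
    ∃ p : ℝ[X], p.natDegree ≤ d ∧ p.coeff d = b ∧
      (∀ k ∈ J, v k = p.eval ((((k : ℕ) : ℝ) + 1) / n)) ∧
      ∀ i, |p.coeff i| ≤ B * coeffFactor d δ := by
  have hn0 : (n : ℝ) ≠ 0 := by
    intro h0
    rw [h0, mul_zero] at hn
    have : (0 : ℝ) ≤ d := Nat.cast_nonneg d
    linarith
  have hcoeff : ∀ i, (C (1 / (n : ℝ) ^ d) * P.comp (C (n : ℝ) * X)).coeff i =
      1 / (n : ℝ) ^ d * (P.coeff i * (n : ℝ) ^ i) := fun i => by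
    rw [coeff_C_mul, comp_C_mul_X_coeff]
  have hdeg : (C (1 / (n : ℝ) ^ d) * P.comp (C (n : ℝ) * X)).natDegree ≤ d := by
    rw [natDegree_le_iff_coeff_eq_zero]
    intro i hi
    rw [hcoeff, coeff_eq_zero_of_natDegree_lt (h.natDegree_eq ▸ hi)]
    simp
  have hv : ∀ k ∈ J, v k =
      (C (1 / (n : ℝ) ^ d) * P.comp (C (n : ℝ) * X)).eval ((((k : ℕ) : ℝ) + 1) / n) := by
    intro k hk
    rw [h.apply_eq k hk, eval_mul, eval_C, eval_comp, eval_mul, eval_C, eval_X,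
      mul_div_cancel₀ _ hn0]
    ring
  refine ⟨_, hdeg, ?_, hv, abs_coeff_le_of_grid hδ hn hJ hdeg fun k hk => ?_⟩
  · rw [hcoeff, ← h.leadingCoeff_eq, leadingCoeff, h.natDegree_eq]
    field_simp
  · rw [← hv k hk]
    exact h.abs_le k hk

open Polynomial in
-- If two indices have small sine, so does the difference of their phases. When the indices are
-- close, that difference is at most 1 and comparable to $\theta p'\cdot(l-k)/n$, so it is small
-- only if they are very close.
theorem card_small_sine_le {n : ℕ} {v : Fin n → ℝ} {E : Finset (Fin n)} {p : ℝ[X]}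
    {C η ζ ε θ y : ℝ} (hv : ∀ k ∈ E, v k = p.eval ((((k : ℕ) : ℝ) + 1) / n))
    (hC : 0 ≤ C) (h1 : ∀ x ∈ Set.Icc (0 : ℝ) 1, |p.derivative.eval x| ≤ C)
    (h2 : ∀ x ∈ Set.Icc (0 : ℝ) 1, |p.derivative.derivative.eval x| ≤ C)
    (hη : 0 < η) (hζ : 0 < ζ) (hζ1 : ζ ≤ 1) (hζC : ζ * C ≤ 1) (hζη : 2 * (ζ * C) ≤ η)
    (hε : 0 < ε) (hθ : 2 * max 1 |θ| ≤ ζ * n)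
    (hgood : ∀ k ∈ E, η ≤ |p.derivative.eval ((((k : ℕ) : ℝ) + 1) / n)|)
    (hsin : ∀ k ∈ E, |Real.sin (θ * (v k - y) / 2)| < ε * min 1 |θ|) :
    (E.card : ℝ) ≤ (16 * ε * n / (η * max 1 |θ|) + 1) * (3 * max 1 |θ| / ζ) := by
  set M := max 1 |θ| with hM
  set τ := min 1 |θ| with hτ
  have hM1 : 1 ≤ M := le_max_left _ _
  have hMτ : M * τ = |θ| := by rw [hM, hτ, max_mul_min, one_mul]
  have hθM : |θ| ≤ M := le_max_right _ _
  have hn : (0 : ℝ) < n := by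
    by_contra h
    have : (n : ℝ) = 0 := le_antisymm (not_lt.1 h) (Nat.cast_nonneg n)
    rw [this] at hθ
    linarith
  -- A gap of at least `R₁` forces the sine of the phase difference up to `2 * (ε * τ)`; a gap below
  -- `R₂` keeps the phase difference at most 1, where `half_abs_le_abs_sin` applies.
  set R₁ := ⌈16 * ε * n / (η * M)⌉₊ with hR₁
  set R₂ := ⌊ζ * n / M⌋₊ with hR₂
  have hR₂le : (R₂ : ℝ) ≤ ζ * n / M := Nat.floor_le (by positivity)
  have hR₂ge : ζ * n / (2 * M) ≤ R₂ := by
    have := Nat.lt_floor_add_one (ζ * n / M)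
    have h3 : 1 ≤ ζ * n / (2 * M) := (one_le_div (by positivity)).2 hθ
    have h4 : ζ * n / M = 2 * (ζ * n / (2 * M)) := by field_simp
    rw [← hR₂] at this
    linarith
  have hR₂pos : 0 < R₂ := by
    have : (0 : ℝ) < R₂ := lt_of_lt_of_le (by positivity) hR₂ge
    exact_mod_cast this
  have hgap : ∀ k ∈ E, ∀ l ∈ E, (k : ℕ) + R₁ ≤ l → ¬ (l : ℕ) < k + R₂ := by
    intro k hk l hl hkl hlt
    have hR₁pos : 0 < R₁ := Nat.ceil_pos.2 (by positivity)
    have hklt : (k : ℕ) < l := by omega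
    set x := (((k : ℕ) : ℝ) + 1) / n with hx
    set x' := (((l : ℕ) : ℝ) + 1) / n with hx'
    have hxx : x' - x = ((l : ℕ) - (k : ℕ) : ℝ) / n := by
      rw [hx, hx']
      ring
    have hxlt : x < x' := by
      rw [← sub_pos, hxx]
      refine div_pos (sub_pos.2 ?_) hn
      exact_mod_cast hklt
    have hup : x' - x ≤ ζ / M := by
      rw [hxx, div_le_iff₀ hn]
      have : ((l : ℕ) : ℝ) < (k : ℕ) + R₂ := by exact_mod_cast hlt
      have h3 : ζ / M * n = ζ * n / M := by ring
      linarith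
    have hlo : 16 * ε / (η * M) ≤ x' - x := by
      rw [hxx, le_div_iff₀ hn]
      have h3 : ((k : ℕ) : ℝ) + R₁ ≤ (l : ℕ) := by exact_mod_cast hkl
      have h4 : 16 * ε * n / (η * M) ≤ R₁ := Nat.le_ceil _
      have h5 : 16 * ε / (η * M) * n = 16 * ε * n / (η * M) := by ring
      linarith
    have hx0 := grid_mem_Icc k
    have hx1 := grid_mem_Icc l
    rw [← hx] at hx0
    rw [← hx'] at hx1
    obtain ⟨z, hz, hpz⟩ := exists_eval_sub_eq p hxlt
    obtain ⟨u, hu, hpu⟩ := exists_eval_sub_eq p.derivative hz.1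
    have hz01 : z ∈ Set.Icc (0 : ℝ) 1 := ⟨hx0.1.trans hz.1.le, hz.2.le.trans hx1.2⟩
    have hu01 : u ∈ Set.Icc (0 : ℝ) 1 := ⟨hx0.1.trans hu.1.le, hu.2.le.trans hz01.2⟩
    have hζM : ζ / M ≤ ζ := div_le_self hζ.le hM1
    have hder : η / 2 ≤ |p.derivative.eval z| := by
      have h3 : |p.derivative.eval z - p.derivative.eval x| ≤ η / 2 := by
        rw [hpu, abs_mul, abs_of_pos (sub_pos.2 hz.1)]
        have : z - x ≤ ζ := by linarith [hz.2]
        have h4 := mul_le_mul (h2 u hu01) this (sub_pos.2 hz.1).le hC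
        linarith
      have h4 := hgood k hk
      have h5 := abs_sub_abs_le_abs_sub (p.derivative.eval x) (p.derivative.eval z)
      rw [abs_sub_comm] at h5
      linarith
    have hvv : v l - v k = p.derivative.eval z * (x' - x) := by rw [hv l hl, hv k hk, hpz]
    have hxpos : 0 < x' - x := sub_pos.2 hxlt
    have habs : |θ * (v l - v k) / 2| = |θ| * |p.derivative.eval z| * (x' - x) / 2 := by
      rw [hvv, abs_div, abs_mul, abs_mul, abs_of_pos hxpos, abs_two]
      ring
    have hle1 : |θ * (v l - v k) / 2| ≤ 1 := by
      rw [habs]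
      have h3 : |θ| * |p.derivative.eval z| * (x' - x) ≤ M * C * (ζ / M) :=
        mul_le_mul (mul_le_mul hθM (h1 z hz01) (abs_nonneg _) (by positivity)) hup hxpos.le
          (by positivity)
      have h4 : M * C * (ζ / M) = ζ * C := by field_simp
      linarith
    have hsl : |Real.sin (θ * (v l - v k) / 2)| < 2 * (ε * τ) := by
      have e1 : θ * (v l - v k) / 2 = θ * (v l - y) / 2 - θ * (v k - y) / 2 := by ring
      rw [e1, Real.sin_sub]
      refine lt_of_le_of_lt (abs_sub _ _) ?_
      rw [abs_mul, abs_mul]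
      have h3 := mul_le_mul_of_nonneg_left (Real.abs_cos_le_one (θ * (v k - y) / 2))
        (abs_nonneg (Real.sin (θ * (v l - y) / 2)))
      have h4 := mul_le_mul_of_nonneg_right (Real.abs_cos_le_one (θ * (v l - y) / 2))
        (abs_nonneg (Real.sin (θ * (v k - y) / 2)))
      linarith [hsin k hk, hsin l hl]
    have h3 := half_abs_le_abs_sin hle1
    rw [habs] at h3
    have h4 : |θ| * (η / 2) * (x' - x) ≤ |θ| * |p.derivative.eval z| * (x' - x) :=
      mul_le_mul_of_nonneg_right (mul_le_mul_of_nonneg_left hder (abs_nonneg θ)) hxpos.le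
    have h5 : |θ| * (η / 2) * (16 * ε / (η * M)) ≤ |θ| * (η / 2) * (x' - x) :=
      mul_le_mul_of_nonneg_left hlo (by positivity)
    have h6 : |θ| * (η / 2) * (16 * ε / (η * M)) = 8 * ε * τ := by
      rw [← hMτ]
      field_simp
      ring
    linarith
  have hcard := card_le_of_forbidden_differences hR₂pos E hgap
  have hcard' : (E.card : ℝ) ≤ R₁ * ((n : ℝ) / R₂ + 1) := by
    have h3 : (E.card : ℝ) ≤ R₁ * (((n / R₂ : ℕ) : ℝ) + 1) := by exact_mod_cast hcard
    have h4 : ((n / R₂ : ℕ) : ℝ) ≤ (n : ℝ) / R₂ := Nat.cast_div_le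
    exact h3.trans (mul_le_mul_of_nonneg_left (by linarith) (Nat.cast_nonneg _))
  refine hcard'.trans (mul_le_mul (Nat.ceil_lt_add_one (by positivity)).le ?_ (by positivity)
    (by positivity))
  have h3 : (n : ℝ) / R₂ ≤ 2 * M / ζ := by
    rw [div_le_div_iff₀ (by exact_mod_cast hR₂pos) hζ]
    rw [div_le_iff₀ (by positivity)] at hR₂ge
    linarith
  have h4 : 1 ≤ M / ζ := (one_le_div hζ).2 (hζ1.trans hM1)
  have h5 : 3 * M / ζ = 2 * M / ζ + M / ζ := by ring
  linarith

open Polynomial in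
/-- The fractional parts of `θ v_k`, `k ∈ J`, do not concentrate near any point. -/
theorem exists_le_sum_sin_sq {d : ℕ} (hd : 1 ≤ d) {δ b B : ℝ} (hδ : 0 < δ) (hb : b ≠ 0)
    (hB : 0 < B) :
    ∃ κ c N : ℝ, 0 < κ ∧ 0 < c ∧ ∀ (n : ℕ) (v : Fin n → ℝ) (J : Finset (Fin n)) (P : ℝ[X]),
      N ≤ n → IsPolynomialOn d b B P J v → δ * n ≤ J.card → ∀ θ y : ℝ, |θ| ≤ κ * n →
        c * min 1 (θ ^ 2) * n ≤ ∑ k ∈ J, Real.sin (θ * (v k - y) / 2) ^ 2 := by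
  obtain ⟨e, rfl⟩ : ∃ e, d = e + 1 := ⟨d - 1, by omega⟩
  set D : ℝ := ((e + 1 : ℕ) : ℝ) with hD
  have hD1 : 1 ≤ D := by rw [hD]; exact_mod_cast hd
  set A : ℝ := B * coeffFactor (e + 1) δ with hA
  have hApos : 0 < A := mul_pos hB (coeffFactor_pos _ hδ)
  set C₀ : ℝ := (D + 1) * (D * (D * A)) with hC₀
  have hC₀pos : 0 < C₀ := by positivity
  have hδ4 : 0 < δ / 4 := by positivity
  have hK := coeffFactor_pos e hδ4
  -- If $|p'|<\eta$ held on a set of density $\delta/4$, the top coefficient $db$ of $p'$ would be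
  -- at most half its own size.
  set η : ℝ := D * |b| / (2 * coeffFactor e (δ / 4)) with hη
  have hηpos : 0 < η := by
    have : 0 < |b| := abs_pos.2 hb
    positivity
  set ζ : ℝ := min 1 (min (1 / C₀) (η / (2 * C₀))) with hζ
  have hζpos : 0 < ζ := by
    rw [hζ]
    positivity
  have hζ1 : ζ ≤ 1 := min_le_left _ _
  have hζC : ζ * C₀ ≤ 1 := by
    rw [← le_div_iff₀ hC₀pos]
    exact (min_le_right _ _).trans (min_le_left _ _)
  have hζη : 2 * (ζ * C₀) ≤ η := by
    have : ζ ≤ η / (2 * C₀) := (min_le_right _ _).trans (min_le_right _ _)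
    rw [le_div_iff₀ (by positivity)] at this
    linarith
  -- `ε` and `κ` make each of the two terms in the bound for small sines at most $\delta n/8$.
  set ε : ℝ := δ * η * ζ / 384 with hε
  have hεpos : 0 < ε := by positivity
  have hδ' : 0 < min δ 1 := lt_min hδ one_pos
  set κ : ℝ := ζ * min δ 1 / 24 with hκ
  have hκpos : 0 < κ := by positivity
  refine ⟨κ, δ * ε ^ 2 / 2, max (1 / κ) (8 * (D + 1) / δ), hκpos, by positivity,
    fun n v J P hn hP hJ θ y hθ => ?_⟩
  have hn1 : 1 ≤ κ * n := by
    have := (le_max_left _ _).trans hn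
    rwa [div_le_iff₀' hκpos] at this
  have hn2 : 8 * (D + 1) ≤ δ * n := by
    have := (le_max_right _ _).trans hn
    rwa [div_le_iff₀' hδ] at this
  have hn0 : (0 : ℝ) < n := pos_of_mul_pos_right (zero_lt_one.trans_le hn1) hκpos.le
  obtain ⟨p, hdeg, hlead, hv, hcoeff⟩ := hP.exists_rescaled hδ hJ (by rw [← hD]; linarith)
  have hdeg' : p.derivative.natDegree ≤ e + 1 := (natDegree_derivative_le p).trans (by omega)
  have hc1 : ∀ i, |p.derivative.coeff i| ≤ D * A := abs_coeff_derivative_le hdeg hcoeff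
  have hc2 : ∀ i, |p.derivative.derivative.coeff i| ≤ D * (D * A) :=
    abs_coeff_derivative_le hdeg' hc1
  have hb1 : ∀ x ∈ Set.Icc (0 : ℝ) 1, |p.derivative.eval x| ≤ C₀ := fun x hx =>
    (abs_eval_le_of_coeff hdeg' hc1 hx).trans (by
      rw [hC₀, ← hD]
      refine mul_le_mul_of_nonneg_left ?_ (by positivity)
      exact le_mul_of_one_le_left (by positivity) hD1)
  have hb2 : ∀ x ∈ Set.Icc (0 : ℝ) 1, |p.derivative.derivative.eval x| ≤ C₀ := fun x hx =>
    abs_eval_le_of_coeff ((natDegree_derivative_le _).trans (by omega)) hc2 hx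
  set F := J.filter fun k : Fin n => |p.derivative.eval ((((k : ℕ) : ℝ) + 1) / n)| < η with hF
  have hFcard : (F.card : ℝ) ≤ δ / 4 * n := by
    by_contra hcon
    have h3 := abs_coeff_le_of_grid hδ4 (e := e) (n := n) (M := η) (G := F)
      (by rw [hD] at hn2; push_cast at hn2; linarith) (not_le.1 hcon).le
      (q := p.derivative) ((natDegree_derivative_le p).trans (by omega))
      (fun k hk => (Finset.mem_filter.1 hk).2.le) e
    rw [coeff_derivative, hlead, hη] at h3
    have e1 : |b * ((e : ℝ) + 1)| = D * |b| := by
      rw [abs_mul, hD, abs_of_nonneg (by positivity : (0 : ℝ) ≤ (e : ℝ) + 1)]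
      push_cast
      ring
    have e2 : D * |b| / (2 * coeffFactor e (δ / 4)) * coeffFactor e (δ / 4) = D * |b| / 2 := by
      field_simp
    rw [e1, e2] at h3
    have : 0 < D * |b| := mul_pos (by linarith) (abs_pos.2 hb)
    linarith
  set E := (J \ F).filter fun k => |Real.sin (θ * (v k - y) / 2)| < ε * min 1 |θ| with hE
  have hEJ : ∀ k ∈ E, k ∈ J ∧ η ≤ |p.derivative.eval ((((k : ℕ) : ℝ) + 1) / n)| := by
    intro k hk
    have h3 := Finset.mem_sdiff.1 (Finset.mem_filter.1 hk).1
    refine ⟨h3.1, ?_⟩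
    by_contra h4
    exact h3.2 (Finset.mem_filter.2 ⟨h3.1, not_le.1 h4⟩)
  have hMle : max 1 |θ| ≤ κ * n := max_le hn1 hθ
  have hM1 : 1 ≤ max 1 |θ| := le_max_left _ _
  have hEcard : (E.card : ℝ) ≤ δ / 4 * n := by
    have h3 := card_small_sine_le (fun k hk => hv k (hEJ k hk).1) hC₀pos.le hb1 hb2 hηpos hζpos
      hζ1 hζC hζη hεpos (θ := θ) (y := y) ?_ (fun k hk => (hEJ k hk).2)
      (fun k hk => (Finset.mem_filter.1 hk).2)
    · refine h3.trans ?_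
      set M := max 1 |θ|
      have e1 : (16 * ε * n / (η * M) + 1) * (3 * M / ζ) = 48 * ε * n / (η * ζ) + 3 * M / ζ := by
        field_simp
        ring
      have e2 : 48 * ε * n / (η * ζ) = δ / 8 * n := by
        rw [hε]
        field_simp
        norm_num
      have e3 : 3 * M / ζ ≤ δ / 8 * n := by
        rw [div_le_iff₀ hζpos]
        have : κ * n ≤ ζ * δ / 24 * n := by
          refine mul_le_mul_of_nonneg_right ?_ hn0.le
          rw [hκ]
          have := mul_le_mul_of_nonneg_left (min_le_left δ 1) hζpos.le
          linarith
        linarith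
      linarith
    · have : κ * n ≤ ζ / 24 * n := by
        refine mul_le_mul_of_nonneg_right ?_ hn0.le
        rw [hκ]
        have := mul_le_mul_of_nonneg_left (min_le_right δ 1) hζpos.le
        linarith
      have h4 : 0 < ζ * n := by positivity
      linarith
  set W := (J \ F) \ E with hW
  have hWcard : δ / 2 * n ≤ W.card := by
    have h3 : J.card ≤ W.card + E.card + F.card := by
      have h4 := Finset.le_card_sdiff F J
      have h5 := Finset.le_card_sdiff E (J \ F)
      rw [← hW] at h5
      omega
    have h4 : (J.card : ℝ) ≤ W.card + E.card + F.card := by exact_mod_cast h3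
    linarith
  have hWsin : ∀ k ∈ W, ε ^ 2 * min 1 (θ ^ 2) ≤ Real.sin (θ * (v k - y) / 2) ^ 2 := by
    intro k hk
    have h3 := Finset.mem_sdiff.1 hk
    have h4 : ε * min 1 |θ| ≤ |Real.sin (θ * (v k - y) / 2)| := by
      by_contra h5
      exact h3.2 (Finset.mem_filter.2 ⟨h3.1, not_le.1 h5⟩)
    have h5 : min 1 (θ ^ 2) = (min 1 |θ|) ^ 2 := by
      rcases le_total 1 |θ| with h | h
      · rw [min_eq_left h, min_eq_left (by rw [← sq_abs]; nlinarith), one_pow]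
      · rw [min_eq_right h, min_eq_right (by rw [← sq_abs]; nlinarith [abs_nonneg θ]), sq_abs]
    rw [h5, ← mul_pow, ← sq_abs (Real.sin _)]
    exact pow_le_pow_left₀ (by positivity) h4 2
  calc δ * ε ^ 2 / 2 * min 1 (θ ^ 2) * n = δ / 2 * n * (ε ^ 2 * min 1 (θ ^ 2)) := by ring
    _ ≤ W.card * (ε ^ 2 * min 1 (θ ^ 2)) :=
        mul_le_mul_of_nonneg_right hWcard (by positivity)
    _ = ∑ k ∈ W, ε ^ 2 * min 1 (θ ^ 2) := by rw [Finset.sum_const, nsmul_eq_mul]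
    _ ≤ ∑ k ∈ W, Real.sin (θ * (v k - y) / 2) ^ 2 := Finset.sum_le_sum hWsin
    _ ≤ ∑ k ∈ J, Real.sin (θ * (v k - y) / 2) ^ 2 :=
        Finset.sum_le_sum_of_subset_of_nonneg
          (Finset.sdiff_subset.trans Finset.sdiff_subset) fun _ _ _ => sq_nonneg _

/-! ### Sub-Gaussian exponential moments -/

/-- The right side is the chord of `exp` over $[-M,M]$; summing it gives Hoeffding's lemma below. -/
theorem exp_le_cosh_add_mul_sinh {M x : ℝ} (hx : |x| ≤ M) (hM : 0 < M) :
    Real.exp x ≤ Real.cosh M + x / M * Real.sinh M := by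
  have h1 := (abs_le.1 hx).1
  have h2 := (abs_le.1 hx).2
  have hexp : ConvexOn ℝ Set.univ Real.exp := convexOn_exp
  obtain ⟨-, hconv⟩ := hexp
  have hc := hconv (Set.mem_univ (-M)) (Set.mem_univ M)
    (a := (M - x) / (2 * M)) (b := (M + x) / (2 * M)) (by apply div_nonneg <;> linarith)
    (by apply div_nonneg <;> linarith) (by field_simp; ring)
  have e1 : ((M - x) / (2 * M)) • -M + ((M + x) / (2 * M)) • M = x := by
    simp only [smul_eq_mul]
    field_simp
    ring
  rw [e1] at hc
  refine hc.trans_eq ?_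
  rw [Real.cosh_eq, Real.sinh_eq, smul_eq_mul, smul_eq_mul]
  field_simp
  ring

theorem sum_exp_le_of_sum_eq_zero {ι : Type*} [Fintype ι] {x : ι → ℝ} {M : ℝ}
    (hx : ∀ i, |x i| ≤ M) (h0 : ∑ i, x i = 0) :
    ∑ i, Real.exp (x i) ≤ Fintype.card ι * Real.exp (M ^ 2 / 2) := by
  rcases isEmpty_or_nonempty ι with h | ⟨⟨i₀⟩⟩
  · simp
  rcases ((abs_nonneg _).trans (hx i₀)).eq_or_lt with hM | hM
  · have : ∀ i, x i = 0 := fun i => abs_nonpos_iff.1 ((hx i).trans_eq hM.symm)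
    simp [this, ← hM]
  · calc ∑ i, Real.exp (x i) ≤ ∑ i, (Real.cosh M + x i / M * Real.sinh M) :=
        Finset.sum_le_sum fun i _ => exp_le_cosh_add_mul_sinh (hx i) hM
      _ = Fintype.card ι * Real.cosh M := by
        rw [Finset.sum_add_distrib, ← Finset.sum_mul, ← Finset.sum_div, h0]
        simp
      _ ≤ _ := mul_le_mul_of_nonneg_left (Real.cosh_le_exp_half_sq M) (Nat.cast_nonneg _)

/-- Splitting a permutation sum according to the image of the first index. -/
theorem sum_perm_succ_eq {n : ℕ} (w v : Fin (n + 1) → ℝ) (F : ℝ → ℝ) :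
    ∑ π, F (permSum w v π) = ∑ p : Fin (n + 1), ∑ σ : Equiv.Perm (Fin n),
      F (w 0 * v p + permSum (fun i => w i.succ) (fun i => v (Equiv.swap 0 p i.succ)) σ) := by
  rw [← Equiv.sum_comp Equiv.Perm.decomposeFin.symm, Fintype.sum_prod_type]
  refine Finset.sum_congr rfl fun p _ => Finset.sum_congr rfl fun σ _ => ?_
  congr 1
  simp [permSum, Fin.sum_univ_succ, Equiv.Perm.decomposeFin_symm_apply_zero,
    Equiv.Perm.decomposeFin_symm_apply_succ]

theorem sum_swap_zero_succ {n : ℕ} (v : Fin (n + 1) → ℝ) (p : Fin (n + 1)) :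
    ∑ i : Fin n, v (Equiv.swap 0 p i.succ) = ∑ i, v i - v p := by
  have h := Equiv.sum_comp (Equiv.swap 0 p) v
  rw [Fin.sum_univ_succ, Equiv.swap_apply_left] at h
  linarith

/-- Sub-Gaussian bound for permutation sums. -/
theorem sum_exp_permSum_sub_le {R : ℝ} (n : ℕ) : ∀ (w v : Fin n → ℝ), (∀ k, |v k| ≤ R) →
    ∑ π, Real.exp (permSum w v π - (∑ i, w i) * (∑ i, v i) / n) ≤
      n.factorial * Real.exp (4 * R ^ 2 * (∑ i, w i ^ 2 - (∑ i, w i) ^ 2 / n)) := by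
  induction n with
  | zero => intro w v _; simp [permSum]
  | succ n ih =>
    intro w v hv
    rcases Nat.eq_zero_or_pos n with rfl | hn
    · simp [permSum]
    have hn' : (0 : ℝ) < n := Nat.cast_pos.2 hn
    set W := ∑ i : Fin n, w i.succ with hW
    set Q := ∑ i : Fin n, w i.succ ^ 2 with hQ
    set V := ∑ i, v i with hV
    -- Fixing the image `p` of index 0 shifts the conditional mean by `D * (v p - V / (n + 1))`, a
    -- centred variable to which Hoeffding's lemma applies.
    set D := w 0 - W / n with hD
    rw [Fin.sum_univ_succ w, Fin.sum_univ_succ (fun i => w i ^ 2)]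
    rw [← hW, ← hQ]
    rw [sum_perm_succ_eq w v (fun s => Real.exp (s - (w 0 + W) * V / (n + 1 : ℕ)))]
    have hinner : ∀ p : Fin (n + 1), ∑ σ : Equiv.Perm (Fin n), Real.exp (w 0 * v p +
        permSum (fun i => w i.succ) (fun i => v (Equiv.swap 0 p i.succ)) σ -
          (w 0 + W) * V / (n + 1 : ℕ)) ≤
        Real.exp (D * (v p - V / (n + 1 : ℕ))) *
          (n.factorial * Real.exp (4 * R ^ 2 * (Q - W ^ 2 / n))) := by
      intro p
      have h1 := ih (fun i => w i.succ) (fun i => v (Equiv.swap 0 p i.succ)) fun k => hv _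
      rw [sum_swap_zero_succ, ← hW, ← hV] at h1
      have h2 := mul_le_mul_of_nonneg_left h1
        (Real.exp_pos (D * (v p - V / (n + 1 : ℕ)))).le
      rw [Finset.mul_sum] at h2
      refine le_trans (le_of_eq (Finset.sum_congr rfl fun σ _ => ?_)) h2
      rw [← Real.exp_add]
      congr 1
      rw [hD]
      push_cast
      field_simp
      ring
    have hVb : ∀ p, |v p - V / (n + 1 : ℕ)| ≤ 2 * R := by
      intro p
      have h1 : |V / (n + 1 : ℕ)| ≤ R := by
        rw [abs_div, abs_of_nonneg (Nat.cast_nonneg (n + 1) : (0 : ℝ) ≤ (n + 1 : ℕ)), div_le_iff₀ (by positivity)]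
        refine (Finset.abs_sum_le_sum_abs _ _).trans ((Finset.sum_le_sum fun i _ => hv i).trans ?_)
        rw [Finset.sum_const, Finset.card_univ, Fintype.card_fin, nsmul_eq_mul, mul_comm]
      have h2 := abs_sub (v p) (V / (n + 1 : ℕ))
      linarith [hv p]
    have houter := sum_exp_le_of_sum_eq_zero
      (x := fun p : Fin (n + 1) => D * (v p - V / (n + 1 : ℕ))) (M := |D| * (2 * R))
      (fun p => by
        rw [abs_mul]
        exact mul_le_mul_of_nonneg_left (hVb p) (abs_nonneg _))
      (by
        rw [← Finset.mul_sum, Finset.sum_sub_distrib, ← hV, Finset.sum_const, Finset.card_univ,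
          Fintype.card_fin, nsmul_eq_mul, mul_div_cancel₀ _ (by positivity), sub_self, mul_zero])
    rw [Fintype.card_fin] at houter
    refine (Finset.sum_le_sum fun p _ => hinner p).trans ?_
    rw [← Finset.sum_mul]
    refine (mul_le_mul_of_nonneg_right houter (by positivity)).trans ?_
    have e1 : ((n + 1 : ℕ) : ℝ) * Real.exp ((|D| * (2 * R)) ^ 2 / 2) *
        (n.factorial * Real.exp (4 * R ^ 2 * (Q - W ^ 2 / n))) =
        ((n + 1).factorial : ℝ) *
          Real.exp (2 * R ^ 2 * D ^ 2 + 4 * R ^ 2 * (Q - W ^ 2 / n)) := by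
      rw [Nat.factorial_succ, Real.exp_add, mul_pow, sq_abs]
      push_cast
      ring_nf
    rw [e1]
    refine mul_le_mul_of_nonneg_left (Real.exp_le_exp.2 ?_) (by positivity)
    have e2 : w 0 ^ 2 + Q - (w 0 + W) ^ 2 / ((n + 1 : ℕ) : ℝ) =
        (Q - W ^ 2 / n) + D ^ 2 * (n / (n + 1)) := by
      rw [hD]
      push_cast
      field_simp
      ring
    rw [e2, mul_add]
    -- Hoeffding costs $2R^2D^2$, while the centred square sum of `w` grows by $D^2n/(n+1)\ge
    -- D^2/2$; hence the constant $4R^2$.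
    have h3 : (1 : ℝ) / 2 ≤ n / (n + 1) := by
      rw [div_le_div_iff₀ two_pos (by positivity)]
      have : (1 : ℝ) ≤ n := by exact_mod_cast hn
      linarith
    have h4 : 4 * R ^ 2 * D ^ 2 * (1 / 2) ≤ 4 * R ^ 2 * D ^ 2 * (n / (n + 1)) :=
      mul_le_mul_of_nonneg_left h3 (by positivity)
    linarith

theorem sum_exp_mul_permSum_le {n : ℕ} {w v : Fin n → ℝ} {R : ℝ} (hv : ∀ k, |v k| ≤ R)
    (h0 : ∑ i, w i = 0) (h1 : ∑ i, w i ^ 2 = 1) (s : ℝ) :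
    ∑ π, Real.exp (s * permSum w v π) ≤ n.factorial * Real.exp (4 * R ^ 2 * s ^ 2) := by
  have h := sum_exp_permSum_sub_le (R := R) n (fun i => s * w i) v hv
  have e1 : ∀ π, permSum (fun i => s * w i) v π = s * permSum w v π := fun π => by
    simp only [permSum, Finset.mul_sum, mul_assoc]
  simp only [e1, mul_pow, ← Finset.mul_sum, h0, h1] at h
  simpa using h

/-! ### Smoothing with the Fejér kernel -/

theorem integral_triangle_mul_cos {N x : ℝ} (hN : N ≠ 0) (hx : x ≠ 0) :
    ∫ t in (0 : ℝ)..N, (1 - t / N) * Real.cos (t * x) = (1 - Real.cos (N * x)) / (N * x ^ 2) := by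
  have hd : ∀ t ∈ Set.uIcc 0 N, HasDerivAt
      (fun t => (1 - t / N) * (Real.sin (t * x) / x) - Real.cos (t * x) / (N * x ^ 2))
      ((1 - t / N) * Real.cos (t * x)) t := by
    intro t _
    have h1 : HasDerivAt (fun t : ℝ => t * x) x t := by simpa using (hasDerivAt_id t).mul_const x
    have h2 : HasDerivAt (fun t : ℝ => 1 - t / N) (-(1 / N)) t :=
      ((hasDerivAt_id t).div_const N).const_sub 1
    have h3 := (h2.mul (h1.sin.div_const x)).sub (h1.cos.div_const (N * x ^ 2))
    refine h3.congr_deriv ?_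
    field_simp
    ring
  rw [intervalIntegral.integral_eq_sub_of_hasDerivAt hd
    (Continuous.intervalIntegrable (by fun_prop) _ _)]
  simp [hN]
  ring

theorem integral_triangle_mul_cos_nonneg {N : ℝ} (hN : 0 < N) (x : ℝ) :
    0 ≤ ∫ t in (0 : ℝ)..N, (1 - t / N) * Real.cos (t * x) := by
  rcases eq_or_ne x 0 with rfl | hx
  · refine intervalIntegral.integral_nonneg hN.le fun t ht => ?_
    have := (div_le_one hN).2 ht.2
    simpa using this
  · rw [integral_triangle_mul_cos hN.ne' hx]
    have := Real.cos_le_one (N * x)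
    exact div_nonneg (by linarith) (by positivity)

theorem div_six_le_integral_triangle_mul_cos {N : ℝ} (hN : 0 < N) {x : ℝ} (hx : |x| ≤ 1 / N) :
    N / 6 ≤ ∫ t in (0 : ℝ)..N, (1 - t / N) * Real.cos (t * x) := by
  rcases eq_or_ne x 0 with rfl | hx0
  · have : ∫ t in (0 : ℝ)..N, (1 - t / N) * Real.cos (t * 0) = N / 2 := by
      simp [intervalIntegral.integral_sub]
      field_simp
      norm_num
    linarith
  · rw [integral_triangle_mul_cos hN.ne' hx0]
    have h1 : |N * x| ≤ 1 := by
      rw [abs_mul, abs_of_pos hN]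
      rwa [le_div_iff₀' hN] at hx
    have h2 := Real.cos_le_one_sub_mul_cos_sq (x := N * x)
      (h1.trans (by linarith [Real.pi_gt_three]))
    have h3 : 1 / 6 ≤ 2 / Real.pi ^ 2 := by
      rw [div_le_div_iff₀ (by norm_num) (by positivity)]
      nlinarith [Real.pi_lt_d2, Real.pi_gt_three]
    have h4 := mul_le_mul_of_nonneg_right h3 (sq_nonneg (N * x))
    rw [le_div_iff₀ (by positivity)]
    nlinarith

/-- The Fejér kernel is nonnegative and at least $N/6$ on $|x|\le1/N$, so it majorises the indicator
of the event. There the tilt $e^{l(S-L)}$ is at least $e^{-|l|/N}$, so inserting it costs only that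
factor. -/
theorem ncard_near_mul_le {Ω : Type*} [Fintype Ω] (S : Ω → ℝ) {N : ℝ} (hN : 0 < N) (L l : ℝ)
    {H : ℝ → ℝ} (hHi : Continuous H)
    (hH : ∀ t ∈ Set.Icc 0 N, ‖∑ ω, Complex.exp ((l + t * Complex.I) * S ω)‖ ≤ H t) :
    ({ω | |S ω - L| ≤ 1 / N}.ncard : ℝ) * (N / 6) ≤
      Real.exp (|l| / N - l * L) * ∫ t in (0 : ℝ)..N, H t := by
  classical
  set k : ℝ → ℝ := fun x => ∫ t in (0 : ℝ)..N, (1 - t / N) * Real.cos (t * x) with hk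
  have hpt : ∀ ω, (if |S ω - L| ≤ 1 / N then N / 6 else 0) ≤
      Real.exp (|l| / N) * (Real.exp (l * (S ω - L)) * k (S ω - L)) := by
    intro ω
    have h0 := integral_triangle_mul_cos_nonneg hN (S ω - L)
    split_ifs with h
    · have h1 := div_six_le_integral_triangle_mul_cos hN h
      rw [← mul_assoc, ← Real.exp_add]
      have h2 : 1 ≤ Real.exp (|l| / N + l * (S ω - L)) := by
        refine Real.one_le_exp ?_
        have h3 := mul_le_mul_of_nonneg_left h (abs_nonneg l)
        have h4 := neg_abs_le (l * (S ω - L))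
        rw [abs_mul] at h4
        rw [mul_one_div] at h3
        linarith
      exact h1.trans (le_mul_of_one_le_left h0 h2)
    · positivity
  have hsum : ({ω | |S ω - L| ≤ 1 / N}.ncard : ℝ) * (N / 6) =
      ∑ ω, if |S ω - L| ≤ 1 / N then N / 6 else 0 := by
    rw [← Finset.sum_filter, Finset.sum_const, nsmul_eq_mul, Set.ncard_eq_toFinset_card']
    simp
  have hint : ∑ ω, Real.exp (l * (S ω - L)) * k (S ω - L) =
      ∫ t in (0 : ℝ)..N, (1 - t / N) *
        ∑ ω, Real.exp (l * (S ω - L)) * Real.cos (t * (S ω - L)) := by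
    simp only [hk, ← intervalIntegral.integral_const_mul]
    rw [← intervalIntegral.integral_finsetSum]
    · refine intervalIntegral.integral_congr fun t _ => ?_
      simp only [Finset.mul_sum]
      exact Finset.sum_congr rfl fun ω _ => by ring
    · intro ω _
      exact Continuous.intervalIntegrable (by fun_prop) _ _
  have hbound : ∀ t ∈ Set.Icc 0 N, (1 - t / N) *
      ∑ ω, Real.exp (l * (S ω - L)) * Real.cos (t * (S ω - L)) ≤ Real.exp (-(l * L)) * H t := by
    intro t ht
    have h1 : 0 ≤ 1 - t / N := sub_nonneg.2 ((div_le_one hN).2 ht.2)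
    have h2 : 1 - t / N ≤ 1 := sub_le_self _ (div_nonneg ht.1 hN.le)
    have hre : ∑ ω, Real.exp (l * (S ω - L)) * Real.cos (t * (S ω - L)) =
        (Complex.exp (-((l + t * Complex.I) * L)) *
          ∑ ω, Complex.exp ((l + t * Complex.I) * S ω)).re := by
      rw [Finset.mul_sum, Complex.re_sum]
      refine Finset.sum_congr rfl fun ω _ => ?_
      rw [← Complex.exp_add, Complex.exp_re]
      simp
      ring_nf
    have hn : ‖Complex.exp (-((l + t * Complex.I) * L))‖ = Real.exp (-(l * L)) := by
      rw [Complex.norm_exp]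
      simp
    have h3 : ∑ ω, Real.exp (l * (S ω - L)) * Real.cos (t * (S ω - L)) ≤
        Real.exp (-(l * L)) * H t := by
      rw [hre]
      refine (Complex.re_le_norm _).trans ?_
      rw [norm_mul, hn]
      exact mul_le_mul_of_nonneg_left (hH t ht) (Real.exp_pos _).le
    have h4 : 0 ≤ Real.exp (-(l * L)) * H t :=
      mul_nonneg (Real.exp_pos _).le ((norm_nonneg _).trans (hH t ht))
    nlinarith [mul_le_mul_of_nonneg_left h3 h1]
  have hle : ∑ ω, Real.exp (l * (S ω - L)) * k (S ω - L) ≤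
      Real.exp (-(l * L)) * ∫ t in (0 : ℝ)..N, H t := by
    rw [hint, ← intervalIntegral.integral_const_mul]
    refine intervalIntegral.integral_mono_on hN.le ?_ ?_ hbound
    · exact Continuous.intervalIntegrable (by fun_prop) _ _
    · exact Continuous.intervalIntegrable (by fun_prop) _ _
  rw [hsum]
  refine (Finset.sum_le_sum fun ω _ => hpt ω).trans ?_
  rw [← Finset.mul_sum, sub_eq_add_neg, Real.exp_add, mul_assoc]
  exact mul_le_mul_of_nonneg_left hle (Real.exp_pos _).le

/-! ### Decay of the tilted characteristic function -/

theorem permSum_mul_swap {n : ℕ} (w v : Fin n → ℝ) (π : Equiv.Perm (Fin n)) {x y : Fin n}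
    (hxy : x ≠ y) :
    permSum w v (π * Equiv.swap x y) = permSum w v π + (w x - w y) * (v (π y) - v (π x)) := by
  rw [← sub_eq_iff_eq_add']
  simp only [permSum, Equiv.Perm.mul_apply]
  rw [← Finset.sum_sub_distrib, Fintype.sum_eq_add x y hxy]
  · rw [Equiv.swap_apply_left, Equiv.swap_apply_right]
    ring
  · intro i hi
    rw [Equiv.swap_apply_of_ne_of_ne hi.1 hi.2, sub_self]

/-- The damping factor of the tilted characteristic function coming from the pair `x, y`. -/
noncomputable def sineGap {n : ℕ} (w v : Fin n → ℝ) (t : ℝ) (x y a b : Fin n) : ℝ :=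
  1 / 4 * Real.sin (t * (w x - w y) * (v a - v b) / 2) ^ 2

theorem sineGap_nonneg {n : ℕ} (w v : Fin n → ℝ) (t : ℝ) (x y a b : Fin n) :
    0 ≤ sineGap w v t x y a b := by
  unfold sineGap
  positivity

theorem sineGap_le_one {n : ℕ} (w v : Fin n → ℝ) (t : ℝ) (x y a b : Fin n) :
    sineGap w v t x y a b ≤ 1 := by
  have := Real.sin_sq_le_one (t * (w x - w y) * (v a - v b) / 2)
  unfold sineGap
  linarith

theorem sineGap_comm {n : ℕ} (w v : Fin n → ℝ) (t : ℝ) (x y a b : Fin n) :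
    sineGap w v t x y a b = sineGap w v t x y b a := by
  unfold sineGap
  rw [← neg_sub (v b) (v a), mul_neg, neg_div, Real.sin_neg, neg_sq]

theorem norm_sum_exp_permSum_le {n : ℕ} {ι : Type*} [Fintype ι] [DecidableEq ι] (w v : Fin n → ℝ)
    {x y : ι → Fin n} (hx : Function.Injective x) (hy : Function.Injective y)
    (hxy : ∀ k l, x k ≠ y l) (l t : ℝ)
    (hl : ∀ k a b, |l * ((w (x k) - w (y k)) * (v a - v b))| ≤ 1) :
    ‖∑ π, Complex.exp ((l + t * Complex.I) * permSum w v π)‖ ≤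
      ∑ π, Real.exp (l * permSum w v π) *
        ∏ k, (1 - sineGap w v t (x k) (y k) (π (x k)) (π (y k))) := by
  set σ : ι → Equiv.Perm (Fin n) := fun k => Equiv.swap (x k) (y k) with hσ
  set D : ι → Equiv.Perm (Fin n) → ℝ :=
    fun k π => (w (x k) - w (y k)) * (v (π (y k)) - v (π (x k))) with hD
  have hS : ∀ k π, permSum w v (π * σ k) = permSum w v π + D k π := fun k π =>
    permSum_mul_swap w v π (hxy k k)
  have hfix : ∀ k j, k ≠ j → σ j (x k) = x k ∧ σ j (y k) = y k := fun k j hkj =>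
    ⟨Equiv.swap_apply_of_ne_of_ne (hx.ne hkj) (hxy k j),
      Equiv.swap_apply_of_ne_of_ne (hxy j k).symm (hy.ne hkj)⟩
  have hDσ : ∀ k j, k ≠ j → ∀ π, D k (π * σ j) = D k π := fun k j hkj π => by
    simp only [hD, Equiv.Perm.mul_apply, (hfix k j hkj).1, (hfix k j hkj).2]
  set Q : Equiv.Perm (Fin n) → ℝ :=
    fun π => ∏ k, (1 - sineGap w v t (x k) (y k) (π (x k)) (π (y k))) with hQ
  have hQσ : ∀ k π, Q (π * σ k) = Q π := by
    intro k π
    refine Finset.prod_congr rfl fun j _ => ?_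
    rcases eq_or_ne j k with rfl | hjk
    · simp only [hσ, Equiv.Perm.mul_apply, Equiv.swap_apply_left, Equiv.swap_apply_right]
      rw [sineGap_comm]
    · simp only [Equiv.Perm.mul_apply, (hfix j k hjk).1, (hfix j k hjk).2]
  have h1 := sum_mul_prod_one_add_div_two σ
    (fun π => Complex.exp ((l + t * Complex.I) * permSum w v π))
    (fun k π => Complex.exp ((l * D k π : ℝ) + (t * D k π : ℝ) * Complex.I))
    (fun k π => by
      rw [hS, ← Complex.exp_add]
      congr 1
      push_cast
      ring)
    (fun k j hkj π => by rw [hDσ k j hkj]) Finset.univ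
  -- The damping product `Q` is invariant under the swaps, so the same averaging identity, read
  -- backwards with real weights, removes the factors $(1+e^{lD_k})/2$.
  have h2 := sum_mul_prod_one_add_div_two σ (fun π => Real.exp (l * permSum w v π) * Q π)
    (fun k π => Real.exp (l * D k π))
    (fun k π => by
      rw [hS, hQσ, mul_add, Real.exp_add]
      ring)
    (fun k j hkj π => by rw [hDσ k j hkj]) Finset.univ
  rw [← h1, ← h2]
  refine (norm_sum_le _ _).trans (Finset.sum_le_sum fun π _ => ?_)
  have e1 : ‖Complex.exp ((l + t * Complex.I) * permSum w v π)‖ = Real.exp (l * permSum w v π) := by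
    rw [Complex.norm_exp]
    simp
  rw [norm_mul, e1, norm_prod, mul_assoc, hQ, ← Finset.prod_mul_distrib]
  refine mul_le_mul_of_nonneg_left ?_ (Real.exp_pos _).le
  refine Finset.prod_le_prod (fun _ _ => norm_nonneg _) fun k _ => ?_
  refine (norm_one_add_exp_div_two_le (l * D k π) (t * D k π) (hl k _ _)).trans_eq ?_
  rw [mul_comm, sineGap_comm, sineGap, hD]
  ring_nf

/-- Cauchy–Schwarz; the damping product lies in $[0,1]$, so its square is at most itself. -/
theorem norm_sum_exp_permSum_le_sqrt_mul_sqrt {n : ℕ} {ι : Type*} [Fintype ι] [DecidableEq ι]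
    (w v : Fin n → ℝ) {x y : ι → Fin n} (hx : Function.Injective x) (hy : Function.Injective y)
    (hxy : ∀ k l, x k ≠ y l) (l t : ℝ)
    (hl : ∀ k a b, |l * ((w (x k) - w (y k)) * (v a - v b))| ≤ 1) :
    ‖∑ π, Complex.exp ((l + t * Complex.I) * permSum w v π)‖ ≤
      √(∑ π, Real.exp (2 * l * permSum w v π)) *
        √(∑ π : Equiv.Perm (Fin n),
          ∏ k, (1 - sineGap w v t (x k) (y k) (π (x k)) (π (y k)))) := by
  refine (norm_sum_exp_permSum_le w v hx hy hxy l t hl).trans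
    ((Real.sum_mul_le_sqrt_mul_sqrt _ _ _).trans ?_)
  have e1 : ∀ π, Real.exp (l * permSum w v π) ^ 2 = Real.exp (2 * l * permSum w v π) := fun π => by
    rw [← Real.exp_nat_mul]
    congr 1
    push_cast
    ring
  simp only [e1]
  refine mul_le_mul_of_nonneg_left (Real.sqrt_le_sqrt (Finset.sum_le_sum fun π _ => ?_))
    (Real.sqrt_nonneg _)
  refine pow_le_of_le_one (Finset.prod_nonneg fun k _ => sub_nonneg.2 (sineGap_le_one _ _ _ _ _ _ _))
    (Finset.prod_le_one (fun k _ => sub_nonneg.2 (sineGap_le_one _ _ _ _ _ _ _))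
      fun k _ => sub_le_self _ (sineGap_nonneg _ _ _ _ _ _ _)) two_ne_zero

theorem sum_offDiag_eq_sum_sum {α : Type*} [DecidableEq α] (s : Finset α) (g : α → α → ℝ)
    (hg : ∀ a, g a a = 0) :
    ∑ p ∈ s.offDiag, g p.1 p.2 = ∑ a ∈ s, ∑ b ∈ s, g a b := by
  rw [← Finset.sum_product' s s g]
  refine Finset.sum_subset (fun p hp => ?_) fun p hp hp' => ?_
  · rw [Finset.mem_offDiag] at hp
    exact Finset.mem_product.2 ⟨hp.1, hp.2.1⟩
  · rw [Finset.mem_product] at hp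
    simp only [Finset.mem_offDiag, hp.1, hp.2, true_and, ne_eq, not_not] at hp'
    rw [hp', hg]

theorem IsPolynomialOn.mono {n d : ℕ} {b B : ℝ} {P : Polynomial ℝ} {I J : Finset (Fin n)}
    {v : Fin n → ℝ} (h : IsPolynomialOn d b B P I v) (hJ : J ⊆ I) :
    IsPolynomialOn d b B P J v :=
  ⟨h.natDegree_eq, h.leadingCoeff_eq, fun k hk => h.apply_eq k (hJ hk),
    fun k hk => h.abs_le k (hJ hk)⟩

theorem IsNondegenerate.two_le {n : ℕ} {A : ℝ} {w : Fin n → ℝ} (h : IsNondegenerate A w) :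
    2 ≤ n := by
  by_contra hn
  have h1 := h.sum_sq_eq_one
  have h0 := h.sum_eq_zero
  obtain rfl | rfl : n = 0 ∨ n = 1 := by omega
  · simp at h1
  · simp only [Finset.univ_unique, Finset.sum_singleton] at h0 h1
    rw [h0] at h1
    norm_num at h1

theorem IsNondegenerate.abs_sub_le {n : ℕ} {A : ℝ} {w : Fin n → ℝ} (h : IsNondegenerate A w)
    (hA : 0 < A) (i j : Fin n) : |w i - w j| ≤ 1 / (A * √(Real.log n)) := by
  rcases eq_or_ne i j with rfl | hij
  · rw [sub_self, abs_zero]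
    positivity
  · exact h.separation i j hij

/-- The squared gaps sum to $2n$ over all $n^2$ ordered pairs. The bound forces `n` to be large when
`A` is large, so small `n` needs no separate treatment. -/
theorem IsNondegenerate.two_mul_sq_mul_log_le {n : ℕ} {A : ℝ} {w : Fin n → ℝ}
    (h : IsNondegenerate A w) (hA : 0 < A) : 2 * (A ^ 2 * Real.log n) ≤ n := by
  have hn2 : (2 : ℝ) ≤ n := by exact_mod_cast h.two_le
  have hlog : 0 < Real.log n := Real.log_pos (by linarith)
  have hsq : ∀ i j, (w i - w j) ^ 2 ≤ 1 / (A ^ 2 * Real.log n) := by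
    intro i j
    have h1 := pow_le_pow_left₀ (abs_nonneg _) (h.abs_sub_le hA i j) 2
    rwa [sq_abs, div_pow, mul_pow, Real.sq_sqrt hlog.le, one_pow] at h1
  have h2 : ∑ i, ∑ j, (w i - w j) ^ 2 = 2 * n := by
    simp only [sub_sq, Finset.sum_add_distrib, Finset.sum_sub_distrib, ← Finset.mul_sum,
      h.sum_eq_zero, h.sum_sq_eq_one, Finset.sum_const, Finset.card_univ, Fintype.card_fin,
      nsmul_eq_mul]
    simp
    ring
  have h3 : ∑ i, ∑ j, (w i - w j) ^ 2 ≤ ∑ _i : Fin n, ∑ _j : Fin n, 1 / (A ^ 2 * Real.log n) :=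
    Finset.sum_le_sum fun i _ => Finset.sum_le_sum fun j _ => hsq i j
  simp only [Finset.sum_const, Finset.card_univ, Fintype.card_fin, nsmul_eq_mul] at h3
  rw [h2, ← mul_assoc, mul_one_div, le_div_iff₀ (by positivity)] at h3
  have h4 : (0 : ℝ) < n := by linarith
  refine le_of_mul_le_mul_left ?_ h4
  linarith

/-- After discarding few indices, an average over ordered pairs of the damping factor stays
bounded below. -/
theorem mul_card_offDiag_le_sum_sineGap {n : ℕ} {δ c θ : ℝ} (hδ : 0 < δ) (hc : 0 < c)
    {w v : Fin n → ℝ} {I : Finset (Fin n)} {x y : Fin n} {t : ℝ} (hθ : t * (w x - w y) = θ)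
    (hI : δ * n ≤ I.card)
    (hsin : ∀ J ⊆ I, δ / 2 * n ≤ J.card → ∀ z : ℝ,
      c * min 1 (θ ^ 2) * n ≤ ∑ k ∈ J, Real.sin (θ * (v k - z) / 2) ^ 2)
    {T : Finset (Fin n)} (hT : (T.card : ℝ) ≤ δ / 2 * n) (π : Equiv.Perm (Fin n)) :
    δ * c / 8 * min 1 (θ ^ 2) * (Tᶜ.offDiag.card : ℝ) ≤
      ∑ p ∈ Tᶜ.offDiag, sineGap w v t x y (π p.1) (π p.2) := by
  have hm : 0 ≤ min 1 (θ ^ 2) := le_min zero_le_one (sq_nonneg _)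
  rw [sum_offDiag_eq_sum_sum Tᶜ (fun a b => sineGap w v t x y (π a) (π b))
    (fun a => by simp [sineGap])]
  set U := Tᶜ.map π.toEmbedding with hU
  set J := I ∩ U with hJ
  have e1 : ∑ a ∈ Tᶜ, ∑ b ∈ Tᶜ, sineGap w v t x y (π a) (π b) =
      ∑ a ∈ U, ∑ b ∈ U, sineGap w v t x y b a := by
    rw [hU, Finset.sum_map]
    refine Finset.sum_congr rfl fun a _ => ?_
    rw [Finset.sum_map]
    exact Finset.sum_congr rfl fun b _ => sineGap_comm _ _ _ _ _ _ _
  have hJcard : δ / 2 * n ≤ J.card := by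
    have h1 : I ⊆ J ∪ T.map π.toEmbedding := by
      intro a ha
      by_cases h : π.symm a ∈ T
      · refine Finset.mem_union_right _ (Finset.mem_map.2 ⟨_, h, ?_⟩)
        simp
      · refine Finset.mem_union_left _ (Finset.mem_inter.2 ⟨ha, Finset.mem_map.2 ⟨π.symm a, ?_, ?_⟩⟩)
        · exact Finset.mem_compl.2 h
        · simp
    have h2 := (Finset.card_le_card h1).trans (Finset.card_union_le _ _)
    rw [Finset.card_map] at h2
    have h3 : (I.card : ℝ) ≤ J.card + T.card := by exact_mod_cast h2
    linarith
  have h1 : ∑ a ∈ J, ∑ b ∈ J, sineGap w v t x y b a ≤ ∑ a ∈ U, ∑ b ∈ U, sineGap w v t x y b a := by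
    have hJU : J ⊆ U := Finset.inter_subset_right
    refine (Finset.sum_le_sum fun a _ => Finset.sum_le_sum_of_subset_of_nonneg hJU
      fun _ _ _ => sineGap_nonneg _ _ _ _ _ _ _).trans ?_
    exact Finset.sum_le_sum_of_subset_of_nonneg hJU
      fun _ _ _ => Finset.sum_nonneg fun _ _ => sineGap_nonneg _ _ _ _ _ _ _
  -- For fixed `a`, non-concentration is applied around the point `v a`.
  have h2 : ∀ a ∈ J, 1 / 4 * (c * min 1 (θ ^ 2) * n) ≤ ∑ b ∈ J, sineGap w v t x y b a := by
    intro a _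
    simp only [sineGap, hθ, ← Finset.mul_sum]
    exact mul_le_mul_of_nonneg_left (hsin J Finset.inter_subset_left hJcard (v a)) (by norm_num)
  have h3 : (J.card : ℝ) * (1 / 4 * (c * min 1 (θ ^ 2) * n)) ≤
      ∑ a ∈ J, ∑ b ∈ J, sineGap w v t x y b a := by
    rw [← nsmul_eq_mul, ← Finset.sum_const]
    exact Finset.sum_le_sum h2
  have h4 : δ / 2 * n * (1 / 4 * (c * min 1 (θ ^ 2) * n)) ≤
      (J.card : ℝ) * (1 / 4 * (c * min 1 (θ ^ 2) * n)) :=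
    mul_le_mul_of_nonneg_right hJcard (by positivity)
  have h5 : (Tᶜ.offDiag.card : ℝ) ≤ n * n := by
    have h6 : Tᶜ.offDiag.card ≤ n * n := by
      rw [Finset.offDiag_card]
      have := Finset.card_le_univ Tᶜ
      rw [Fintype.card_fin] at this
      exact (Nat.sub_le _ _).trans (Nat.mul_le_mul this this)
    exact_mod_cast h6
  have h6 := mul_le_mul_of_nonneg_left h5 (by positivity : 0 ≤ δ * c / 8 * min 1 (θ ^ 2))
  rw [e1]
  linarith

/-- Disjoint pairs of indices whose `w`-gaps have total square at least a constant. -/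
theorem exists_disjoint_pairs {n : ℕ} {δ : ℝ} (hδ : 0 < δ) (hδ1 : δ ≤ 1) (hn : 16 ≤ δ * n)
    {w : Fin n → ℝ} (h0 : ∑ i, w i = 0) (h1 : ∑ i, w i ^ 2 = 1) :
    ∃ (m : ℕ) (x y : Fin m → Fin n), Function.Injective x ∧ Function.Injective y ∧
      (∀ k l, x k ≠ y l) ∧ (2 * m : ℝ) ≤ δ / 2 * n ∧
      δ / 8 ≤ ∑ k, (w (x k) - w (y k)) ^ 2 := by
  have hn0 : (0 : ℝ) < n := by
    by_contra h
    have : (n : ℝ) = 0 := le_antisymm (not_lt.1 h) (Nat.cast_nonneg n)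
    rw [this] at hn
    linarith
  set m := ⌊δ * n / 8⌋₊ with hm
  have hmle : (m : ℝ) ≤ δ * n / 8 := Nat.floor_le (by positivity)
  have hmge : δ * n / 16 ≤ m := by
    have := Nat.lt_floor_add_one (δ * n / 8)
    rw [← hm] at this
    linarith
  have hmn : 2 * m ≤ n := by
    have h2 : (2 * m : ℝ) ≤ n := by nlinarith
    exact_mod_cast h2
  have hneq : ∀ k l : Fin m, (⟨k, by omega⟩ : Fin n) ≠ ⟨m + l, by omega⟩ := by
    intro k l h
    have := Fin.mk.inj_iff.1 h
    omega
  obtain ⟨τ, hτ⟩ := exists_perm_le_sum_sq_sub w h0 h1 (ι := Fin m)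
    (x := fun k => ⟨k, by omega⟩) (y := fun k => ⟨m + k, by omega⟩) (fun k => hneq k k)
  refine ⟨m, fun k => τ ⟨k, by omega⟩, fun k => τ ⟨m + k, by omega⟩, ?_, ?_, ?_, by linarith, ?_⟩
  · intro k l h
    have := Fin.mk.inj_iff.1 (τ.injective h)
    exact Fin.ext this
  · intro k l h
    have := Fin.mk.inj_iff.1 (τ.injective h)
    exact Fin.ext (by omega)
  · exact fun k l h => hneq k l (τ.injective h)
  · refine le_trans ?_ hτ
    rw [Fintype.card_fin, le_div_iff₀ hn0]
    linarith

/-- For $t\le T$ no minimum is truncated and the sum is at least $st^2$. For $t\ge T$ it is at least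
its value at $T$, and `hlog` turns $e^{-csT^2}$ into $1/n$. -/
theorem exp_neg_sum_min_le {ι : Type*} [Fintype ι] {D : ι → ℝ} {c s T t : ℝ} {n : ℕ} (hn : 0 < n)
    (hc : 0 < c) (hT : 0 < T) (hD : ∀ k, |D k| ≤ 1 / T)
    (hsum : s ≤ ∑ k, D k ^ 2) (hlog : Real.log n ≤ c * s * T ^ 2) (ht : 0 ≤ t) :
    Real.exp (-(c * ∑ k, min 1 ((t * D k) ^ 2))) ≤ Real.exp (-(c * s) * t ^ 2) + 1 / n := by
  have hn' : (0 : ℝ) < n := Nat.cast_pos.2 hn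
  have hDT : ∀ k, (T * D k) ^ 2 ≤ 1 := by
    intro k
    have h1 := hD k
    rw [le_div_iff₀' hT] at h1
    rw [← sq_abs, abs_mul, abs_of_pos hT]
    exact pow_le_one₀ (by positivity) h1
  have hkey : ∀ u, 0 ≤ u → u ≤ T → u ≤ t → c * s * u ^ 2 ≤ c * ∑ k, min 1 ((t * D k) ^ 2) := by
    intro u hu huT hut
    rw [mul_assoc]
    refine mul_le_mul_of_nonneg_left ?_ hc.le
    calc s * u ^ 2 ≤ (∑ k, D k ^ 2) * u ^ 2 := mul_le_mul_of_nonneg_right hsum (sq_nonneg u)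
      _ = ∑ k, (u * D k) ^ 2 := by
        rw [Finset.sum_mul]
        exact Finset.sum_congr rfl fun k _ => by ring
      _ ≤ _ := by
        refine Finset.sum_le_sum fun k _ => le_min (le_trans ?_ (hDT k)) ?_
        · rw [mul_pow, mul_pow]
          exact mul_le_mul_of_nonneg_right (pow_le_pow_left₀ hu huT 2) (sq_nonneg _)
        · rw [mul_pow, mul_pow]
          exact mul_le_mul_of_nonneg_right (pow_le_pow_left₀ hu hut 2) (sq_nonneg _)
  rcases le_total t T with h | h
  · have h1 := hkey t ht h le_rfl
    have h2 : Real.exp (-(c * ∑ k, min 1 ((t * D k) ^ 2))) ≤ Real.exp (-(c * s) * t ^ 2) :=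
      Real.exp_le_exp.2 (by linarith)
    have h3 : 0 < 1 / (n : ℝ) := by positivity
    linarith
  · have h1 := hkey T hT.le le_rfl h
    have h2 : Real.exp (-(c * ∑ k, min 1 ((t * D k) ^ 2))) ≤ Real.exp (-Real.log n) :=
      Real.exp_le_exp.2 (by linarith)
    rw [Real.exp_neg (Real.log n), Real.exp_log hn', ← one_div] at h2
    linarith [Real.exp_pos (-(c * s) * t ^ 2)]

theorem integral_exp_neg_mul_sq_add_le {s : ℝ} (hs : 0 < s) {n : ℕ} (hn : 0 < n) :
    ∫ t in (0 : ℝ)..n, (Real.exp (-s * t ^ 2) + 1 / n) ≤ √(Real.pi / s) / 2 + 1 := by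
  have hn' : (n : ℝ) ≠ 0 := Nat.cast_ne_zero.2 hn.ne'
  have hint : MeasureTheory.Integrable fun t : ℝ => Real.exp (-s * t ^ 2) :=
    integrable_exp_neg_mul_sq hs
  rw [intervalIntegral.integral_add hint.intervalIntegrable (by simp)]
  refine add_le_add ?_ (by simp [hn'])
  rw [← integral_gaussian_Ioi, intervalIntegral.integral_of_le (Nat.cast_nonneg n)]
  exact MeasureTheory.setIntegral_mono_set hint.integrableOn
    (Filter.Eventually.of_forall fun t => (Real.exp_pos _).le)
    (Filter.Eventually.of_forall fun t ht => ht.1)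

/-! ### Small ball estimates and conclusion -/

/-- Small ball estimate in terms of the exponential moment at `2 * l`. -/
theorem exists_permProb_le_of_tilt {d : ℕ} (hd : 1 ≤ d) {δ b B : ℝ} (hδ : 0 < δ) (hb : b ≠ 0)
    (hB : 0 < B) :
    ∃ A₀ : ℝ, 1 ≤ A₀ ∧ ∀ A, A₀ ≤ A → ∀ (n : ℕ) (w v : Fin n → ℝ) (I : Finset (Fin n))
      (P : Polynomial ℝ), IsNondegenerate A w → δ * n ≤ I.card → IsPolynomialOn d b B P I v →
      ∀ l M L : ℝ, (∀ i j, |l| * |v i - v j| ≤ A * √(Real.log n)) → 0 ≤ M →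
        ∑ π, Real.exp (2 * l * permSum w v π) ≤ n.factorial * M ^ 2 →
        permProb {π | |permSum w v π - L| ≤ 1 / (n : ℝ)} ≤
          6 * A * M * Real.exp (|l| / n - l * L) * (1 / n) := by
  -- Density `δ / 2`, because the revealed indices may use up half of `I`.
  obtain ⟨κ, c, N, hκ, hc, hkey⟩ := exists_le_sum_sin_sq hd (half_pos hδ) hb hB
  set c₁ : ℝ := min (δ * c / 8) 1 with hc₁
  have hc₁pos : 0 < c₁ := lt_min (by positivity) one_pos
  -- The half comes from the square root in Cauchy–Schwarz, and `δ / 8` is the total squared gap of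
  -- the pairs.
  set s : ℝ := c₁ / 2 * (δ / 8) with hs
  have hspos : 0 < s := by positivity
  -- `1 / κ` keeps $|tD_k|\le\kappa n$ for $t\le n$; `2`, `N` and `16 / δ` make `n` large through
  -- $A^2\le n$; `1 / s` gives $e^{-sT^2}\le1/n$; the last entry lets `A` absorb the integral, so
  -- that the final constant depends on `A` alone.
  set A₀ : ℝ := max 2 (max (1 / κ) (max N (max (16 / δ) (max (1 / s) (√(Real.pi / s) / 2 + 1)))))
    with hA₀
  refine ⟨A₀, (by norm_num : (1 : ℝ) ≤ 2).trans (le_max_left _ _),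
    fun A hA n w v I P hw hI hP l M L hl hM hexp => ?_⟩
  simp only [hA₀, max_le_iff] at hA
  obtain ⟨hA2, hAκ, hAN, hAδ, hAs, hAint⟩ := hA
  have hA0 : 0 < A := by linarith
  have hn2 : 2 ≤ n := hw.two_le
  have hnpos : 0 < n := by omega
  have hn0 : (0 : ℝ) < n := Nat.cast_pos.2 hnpos
  have hnA : A ^ 2 ≤ n := by
    have h1 := hw.two_mul_sq_mul_log_le hA0
    have h2 : Real.log 2 ≤ Real.log n := Real.log_le_log two_pos (by exact_mod_cast hn2)
    have h3 := Real.log_two_gt_d9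
    have h4 : A ^ 2 * (1 / 2) ≤ A ^ 2 * Real.log n :=
      mul_le_mul_of_nonneg_left (by linarith) (sq_nonneg A)
    linarith
  have hAn : A ≤ n := le_trans (by nlinarith) hnA
  have hlog1 : 1 ≤ Real.log n := by
    rw [Real.le_log_iff_exp_le hn0]
    have : (4 : ℝ) ≤ n := le_trans (by nlinarith) hnA
    linarith [Real.exp_one_lt_d9]
  have hlog0 : 0 ≤ Real.log n := by linarith
  have hsq1 : 1 ≤ √(Real.log n) := Real.one_le_sqrt.2 hlog1
  set T := A * √(Real.log n) with hT
  have hTA : A ≤ T := le_mul_of_one_le_right hA0.le hsq1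
  have hT0 : 0 < T := hA0.trans_le hTA
  have hδn : 16 ≤ δ * n := by
    rw [div_le_iff₀' hδ] at hAδ
    exact hAδ.trans (mul_le_mul_of_nonneg_left hAn hδ.le)
  have hδ1 : δ ≤ 1 := by
    have h1 : (I.card : ℝ) ≤ n := by
      have := Finset.card_le_univ I
      rw [Fintype.card_fin] at this
      exact_mod_cast this
    by_contra h
    nlinarith
  obtain ⟨m, x, y, hx, hy, hxy, hm, hsum⟩ :=
    exists_disjoint_pairs hδ hδ1 hδn hw.sum_eq_zero hw.sum_sq_eq_one
  set D : Fin m → ℝ := fun k => w (x k) - w (y k) with hD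
  have hDT : ∀ k, |D k| ≤ 1 / T := fun k => hw.abs_sub_le hA0 _ _
  have hltilt : ∀ k i j, |l * ((w (x k) - w (y k)) * (v i - v j))| ≤ 1 := by
    intro k i j
    have h1 := mul_le_mul (hDT k) (hl i j) (by positivity) (by positivity)
    rw [one_div, inv_mul_cancel₀ hT0.ne'] at h1
    rw [abs_mul, abs_mul]
    simp only [hD] at h1
    linarith
  have hnorm : ∀ t ∈ Set.Icc (0 : ℝ) n,
      ‖∑ π, Complex.exp ((l + t * Complex.I) * permSum w v π)‖ ≤
        n.factorial * M * (Real.exp (-s * t ^ 2) + 1 / n) := by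
    intro t ht
    refine (norm_sum_exp_permSum_le_sqrt_mul_sqrt w v hx hy hxy l t hltilt).trans ?_
    have hθ : ∀ k, |t * D k| ≤ κ * n := by
      intro k
      rw [abs_mul, abs_of_nonneg ht.1, mul_comm]
      have h1 : 1 / T ≤ κ := by
        rw [div_le_iff₀ hT0]
        rw [div_le_iff₀' hκ] at hAκ
        exact hAκ.trans (mul_le_mul_of_nonneg_left hTA hκ.le)
      exact mul_le_mul ((hDT k).trans h1) ht.2 ht.1 hκ.le
    have hprod := sum_prod_one_sub_le hx hy hxy (fun k => sineGap w v t (x k) (y k))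
      (fun k a b => sineGap_le_one w v t (x k) (y k) a b)
      (fun k => c₁ * min 1 ((t * D k) ^ 2))
      (fun k => mul_le_one₀ (min_le_right _ _) (le_min zero_le_one (sq_nonneg _)) (min_le_left _ _))
      (fun k T' hT' π => by
        have hT'' : (T'.card : ℝ) ≤ δ / 2 * n := by
          rw [Fintype.card_fin] at hT'
          exact le_trans (by exact_mod_cast hT') hm
        refine le_trans ?_ (mul_card_offDiag_le_sum_sineGap hδ hc (w := w) (v := v) (x := x k)
          (y := y k) (t := t) rfl hI (fun J hJ hJc z => hkey n v J P (hAN.trans hAn) (hP.mono hJ)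
            hJc _ z (hθ k)) hT'' π)
        refine mul_le_mul_of_nonneg_right ?_ (Nat.cast_nonneg _)
        exact mul_le_mul_of_nonneg_right (min_le_left _ _) (le_min zero_le_one (sq_nonneg _)))
      Finset.univ
    rw [Fintype.card_fin] at hprod
    have hpe : ∏ k, (1 - c₁ * min 1 ((t * D k) ^ 2)) ≤
        Real.exp (-(c₁ / 2 * ∑ k, min 1 ((t * D k) ^ 2))) ^ 2 := by
      rw [← Real.exp_nat_mul]
      have h1 : ((2 : ℕ) : ℝ) * -(c₁ / 2 * ∑ k, min 1 ((t * D k) ^ 2)) =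
          ∑ k, -(c₁ * min 1 ((t * D k) ^ 2)) := by
        rw [Finset.sum_neg_distrib, ← Finset.mul_sum]
        push_cast
        ring
      rw [h1, Real.exp_sum]
      refine Finset.prod_le_prod (fun k _ => sub_nonneg.2 (mul_le_one₀ (min_le_right _ _)
        (le_min zero_le_one (sq_nonneg _)) (min_le_left _ _))) fun k _ => ?_
      have := Real.add_one_le_exp (-(c₁ * min 1 ((t * D k) ^ 2)))
      linarith
    have hlogs : Real.log n ≤ c₁ / 2 * (δ / 8) * T ^ 2 := by
      rw [← hs, hT, mul_pow, Real.sq_sqrt hlog0, ← mul_assoc]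
      rw [div_le_iff₀' hspos] at hAs
      refine le_mul_of_one_le_left hlog0 (hAs.trans (mul_le_mul_of_nonneg_left ?_ hspos.le))
      nlinarith
    have hdecay := exp_neg_sum_min_le (t := t) hnpos (half_pos hc₁pos) hT0 hDT hsum
      hlogs ht.1
    rw [← hs] at hdecay
    set E := Real.exp (-(c₁ / 2 * ∑ k, min 1 ((t * D k) ^ 2))) with hE
    have hE0 : 0 ≤ E := (Real.exp_pos _).le
    have hfac : (0 : ℝ) ≤ n.factorial := Nat.cast_nonneg _
    have h1 : √(∑ π, Real.exp (2 * l * permSum w v π)) ≤ √(n.factorial) * M := by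
      refine (Real.sqrt_le_sqrt hexp).trans_eq ?_
      rw [Real.sqrt_mul hfac, Real.sqrt_sq hM]
    have h2 : √(∑ π : Equiv.Perm (Fin n),
        ∏ k, (1 - sineGap w v t (x k) (y k) (π (x k)) (π (y k)))) ≤ √(n.factorial) * E := by
      refine (Real.sqrt_le_sqrt (hprod.trans (mul_le_mul_of_nonneg_right hpe hfac))).trans_eq ?_
      rw [mul_comm, Real.sqrt_mul hfac, Real.sqrt_sq hE0]
    calc _ ≤ √(n.factorial) * M * (√(n.factorial) * E) :=
          mul_le_mul h1 h2 (Real.sqrt_nonneg _) (by positivity)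
      _ = n.factorial * M * E := by
          nth_rewrite 3 [← Real.mul_self_sqrt hfac]
          ring
      _ ≤ _ := mul_le_mul_of_nonneg_left hdecay (by positivity)
  have hcount := ncard_near_mul_le (fun π => permSum w v π) hn0 L l
    (H := fun t => n.factorial * M * (Real.exp (-s * t ^ 2) + 1 / n)) (by fun_prop) hnorm
  have hI := (integral_exp_neg_mul_sq_add_le hspos hnpos).trans hAint
  rw [intervalIntegral.integral_const_mul] at hcount
  have hfac : (0 : ℝ) < n.factorial := Nat.cast_pos.2 n.factorial_pos
  have h3 : Real.exp (|l| / n - l * L) * (n.factorial * M *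
      ∫ t in (0 : ℝ)..n, (Real.exp (-s * t ^ 2) + 1 / n)) ≤
      Real.exp (|l| / n - l * L) * (n.factorial * M * A) :=
    mul_le_mul_of_nonneg_left (mul_le_mul_of_nonneg_left hI (by positivity)) (Real.exp_pos _).le
  rw [permProb, div_le_iff₀ hfac, mul_one_div, div_mul_eq_mul_div, le_div_iff₀ hn0]
  linarith

theorem permProb_le_exp {n : ℕ} {w v : Fin n → ℝ} {R : ℝ} (hv : ∀ k, |v k| ≤ R)
    (h0 : ∑ i, w i = 0) (h1 : ∑ i, w i ^ 2 = 1) (l L : ℝ) :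
    permProb {π | |permSum w v π - L| ≤ 1 / (n : ℝ)} ≤
      Real.exp (|l| / n - l * L + 4 * R ^ 2 * l ^ 2) := by
  classical
  have hfac : (0 : ℝ) < n.factorial := Nat.cast_pos.2 n.factorial_pos
  rw [permProb, div_le_iff₀ hfac]
  have hcard : ({π | |permSum w v π - L| ≤ 1 / (n : ℝ)}.ncard : ℝ) =
      ∑ π : Equiv.Perm (Fin n), if |permSum w v π - L| ≤ 1 / (n : ℝ) then (1 : ℝ) else 0 := by
    rw [← Finset.sum_filter, Finset.sum_const, nsmul_eq_mul, Set.ncard_eq_toFinset_card']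
    simp
  have hpt : ∀ π, (if |permSum w v π - L| ≤ 1 / (n : ℝ) then (1 : ℝ) else 0) ≤
      Real.exp (|l| / n - l * L) * Real.exp (l * permSum w v π) := by
    intro π
    split_ifs with h
    · rw [← Real.exp_add]
      refine Real.one_le_exp ?_
      have h3 := mul_le_mul_of_nonneg_left h (abs_nonneg l)
      have h4 := neg_abs_le (l * (permSum w v π - L))
      rw [abs_mul] at h4
      rw [mul_one_div] at h3
      linarith
    · positivity
  rw [hcard]
  refine (Finset.sum_le_sum fun π _ => hpt π).trans ?_
  rw [← Finset.mul_sum, Real.exp_add, mul_assoc, mul_comm (Real.exp (4 * R ^ 2 * l ^ 2))]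
  exact mul_le_mul_of_nonneg_left (sum_exp_mul_permSum_le hv h0 h1 l) (Real.exp_pos _).le

/-- The tilt is $l=aL$ with $a=1/(32R^2+1)$, so the moment cost is a fraction of the gain $aL^2$. If
it violates the admissibility bound of `htilt`, then $\log n\le 4R^2(aL)^2$, and the Chernoff bound
has enough room to supply $1/n$. -/
theorem permProb_le_mul_exp_neg_sq {n : ℕ} {A : ℝ} {w v : Fin n → ℝ} (hw : IsNondegenerate A w)
    (hA : 1 ≤ A) {R : ℝ} (hR : 0 < R) (hv : ∀ k, |v k| ≤ R) (L : ℝ)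
    (htilt : ∀ l M : ℝ, (∀ i j, |l| * |v i - v j| ≤ A * √(Real.log n)) → 0 ≤ M →
      ∑ π, Real.exp (2 * l * permSum w v π) ≤ n.factorial * M ^ 2 →
      permProb {π | |permSum w v π - L| ≤ 1 / (n : ℝ)} ≤
        6 * A * M * Real.exp (|l| / n - l * L) * (1 / n)) :
    permProb {π | |permSum w v π - L| ≤ 1 / (n : ℝ)} ≤
      6 * A * Real.exp (1 / (32 * R ^ 2 + 1) / 4) *
        (1 / n * Real.exp (-(1 / (32 * R ^ 2 + 1) / 4 * L ^ 2))) := by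
  set a : ℝ := 1 / (32 * R ^ 2 + 1) with ha
  have ha0 : 0 < a := by positivity
  have haR : 32 * (R ^ 2 * a) ≤ 1 := by
    have : (32 * R ^ 2 + 1) * a = 1 := by
      rw [ha]
      field_simp
    linarith
  have hn2 : (2 : ℝ) ≤ n := by exact_mod_cast hw.two_le
  have hn0 : (0 : ℝ) < n := by linarith
  have hlog0 : 0 ≤ Real.log n := Real.log_nonneg (by linarith)
  have hL2 : |a * L| / n ≤ a / 4 + a * L ^ 2 / 4 := by
    rw [abs_mul, abs_of_pos ha0, mul_div_assoc]
    have h1 : |L| / n ≤ |L| / 2 := div_le_div_of_nonneg_left (abs_nonneg L) two_pos hn2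
    have h2 : |L| / 2 ≤ (1 + L ^ 2) / 4 := by nlinarith [sq_nonneg (|L| - 1), sq_abs L]
    have h3 := mul_le_mul_of_nonneg_left (h1.trans h2) ha0.le
    linarith
  have haL : 32 * (R ^ 2 * (a * L) ^ 2) ≤ a * L ^ 2 := by
    have h1 := mul_le_mul_of_nonneg_right haR (by positivity : 0 ≤ a * L ^ 2)
    linarith
  have haL0 : 0 ≤ a * L ^ 2 := by positivity
  have hA0 : 0 < A := by linarith
  by_cases hcase : |a * L| * (2 * R) ≤ A * √(Real.log n)
  · have h1 := htilt (a * L) (Real.exp (8 * R ^ 2 * (a * L) ^ 2))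
      (fun i j => le_trans (mul_le_mul_of_nonneg_left
        (by linarith [abs_sub (v i) (v j), hv i, hv j]) (abs_nonneg _)) hcase)
      (Real.exp_pos _).le (by
        have h2 := sum_exp_mul_permSum_le hv hw.sum_eq_zero hw.sum_sq_eq_one (2 * (a * L))
        refine h2.trans_eq ?_
        rw [← Real.exp_nat_mul]
        congr 2
        push_cast
        ring)
    refine h1.trans ?_
    have h3 : Real.exp (8 * R ^ 2 * (a * L) ^ 2) * Real.exp (|a * L| / n - a * L * L) ≤
        Real.exp (a / 4) * Real.exp (-(a / 4 * L ^ 2)) := by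
      rw [← Real.exp_add, ← Real.exp_add]
      exact Real.exp_le_exp.2 (by linarith)
    have h4 := mul_le_mul_of_nonneg_left h3 (by positivity : 0 ≤ 6 * A * (1 / (n : ℝ)))
    linarith
  · have h1 := permProb_le_exp hv hw.sum_eq_zero hw.sum_sq_eq_one (a * L) L
    refine h1.trans ?_
    have h2 : A ^ 2 * Real.log n ≤ 4 * (R ^ 2 * (a * L) ^ 2) := by
      have h3 := pow_le_pow_left₀ (by positivity) (not_le.1 hcase).le 2
      rw [mul_pow, mul_pow, Real.sq_sqrt hlog0, sq_abs] at h3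
      linarith
    have h3 : Real.log n ≤ A ^ 2 * Real.log n :=
      le_mul_of_one_le_left hlog0 (one_le_pow₀ hA)
    have h4 : Real.exp (|a * L| / n - a * L * L + 4 * R ^ 2 * (a * L) ^ 2) ≤
        Real.exp (a / 4) * (1 / n * Real.exp (-(a / 4 * L ^ 2))) := by
      rw [one_div, ← Real.exp_log (inv_pos.2 hn0), Real.log_inv, ← Real.exp_add, ← Real.exp_add]
      exact Real.exp_le_exp.2 (by linarith)
    refine h4.trans (mul_le_mul_of_nonneg_right ?_ (by positivity))
    exact le_mul_of_one_le_left (Real.exp_pos _).le (by linarith)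

theorem theorem1p13 :
    ∃ (A₀ : ℕ → ℝ → ℝ → ℝ → ℝ) (C₁ : ℝ → ℝ) (C₂ c₂ : ℝ → ℝ → ℝ → ℝ),
      (∀ d δ b B, 0 < A₀ d δ b B) ∧ (∀ A, 0 < C₁ A) ∧
      (∀ A B B', 0 < C₂ A B B') ∧ (∀ A B B', 0 < c₂ A B B') ∧
      ∀ (d : ℕ) (δ b B A : ℝ), 2 ≤ d → 0 < δ → b ≠ 0 → 0 < B → A₀ d δ b B ≤ A →
        ∀ (n : ℕ) (w v : Fin n → ℝ) (I : Finset (Fin n)) (P : Polynomial ℝ),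
          IsNondegenerate A w → δ * (n : ℝ) ≤ (I.card : ℝ) → IsPolynomialOn d b B P I v →
            (∀ L : ℝ, permProb {π | |permSum w v π - L| ≤ 1 / (n : ℝ)} ≤ C₁ A * (1 / (n : ℝ))) ∧
            (∀ B' : ℝ, 0 < B' → (∀ k, |v k| ≤ B') →
              ∀ L : ℝ, permProb {π | |permSum w v π - L| ≤ 1 / (n : ℝ)} ≤
                C₂ A B B' * (1 / (n : ℝ) * Real.exp (-(c₂ A B B' * L ^ 2)))) := by
  have hex : ∀ (d : ℕ) (δ b B : ℝ), ∃ A₀ : ℝ, 1 ≤ A₀ ∧ (2 ≤ d → 0 < δ → b ≠ 0 → 0 < B →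
      ∀ A, A₀ ≤ A → ∀ (n : ℕ) (w v : Fin n → ℝ) (I : Finset (Fin n)) (P : Polynomial ℝ),
      IsNondegenerate A w → δ * n ≤ I.card → IsPolynomialOn d b B P I v →
      ∀ l M L : ℝ, (∀ i j, |l| * |v i - v j| ≤ A * √(Real.log n)) → 0 ≤ M →
        ∑ π, Real.exp (2 * l * permSum w v π) ≤ n.factorial * M ^ 2 →
        permProb {π | |permSum w v π - L| ≤ 1 / (n : ℝ)} ≤
          6 * A * M * Real.exp (|l| / n - l * L) * (1 / n)) := by
    intro d δ b B
    by_cases h : 2 ≤ d ∧ 0 < δ ∧ b ≠ 0 ∧ 0 < B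
    · obtain ⟨hd, hδ, hb, hB⟩ := h
      obtain ⟨A₀, h1, h2⟩ := exists_permProb_le_of_tilt (by omega : 1 ≤ d) hδ hb hB
      exact ⟨A₀, h1, fun _ _ _ _ => h2⟩
    -- Outside the parameter range the value 1 is a default that makes `A₀` a total positive
    -- function.
    · exact ⟨1, le_rfl, fun hd hδ hb hB => absurd ⟨hd, hδ, hb, hB⟩ h⟩
  choose A₀ hA₀ hmain using hex
  refine ⟨A₀, fun A => 6 * |A| + 1,
    fun A _ R => (6 * |A| + 1) * Real.exp (1 / (32 * R ^ 2 + 1) / 4),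
    fun _ _ R => 1 / (32 * R ^ 2 + 1) / 4, fun d δ b B => zero_lt_one.trans_le (hA₀ d δ b B),
    fun A => by positivity, fun A B R => by positivity, fun A B R => by positivity, ?_⟩
  intro d δ b B A hd hδ hb hB hA n w v I P hw hI hP
  have htilt := hmain d δ b B hd hδ hb hB A hA n w v I P hw hI hP
  have hA1 : 1 ≤ A := (hA₀ d δ b B).trans hA
  have hA6 : 6 * A ≤ 6 * |A| + 1 := by linarith [le_abs_self A]
  refine ⟨fun L => ?_, fun R hR hv L => ?_⟩
  -- Without tilt the exponential moment is exactly $n!$, so no bound on `v` outside `I` is needed.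
  · have h1 := htilt 0 1 L (fun i j => by rw [abs_zero, zero_mul]; positivity) zero_le_one
      (by simp [Fintype.card_perm])
    refine h1.trans (mul_le_mul_of_nonneg_right ?_ (by positivity))
    simpa using hA6
  · refine (permProb_le_mul_exp_neg_sq hw hA1 hR hv L fun l M => htilt l M L).trans ?_
    exact mul_le_mul_of_nonneg_right
      (mul_le_mul_of_nonneg_right hA6 (Real.exp_pos _).le) (by positivity)
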